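/- Let $G=(V,E)$ be a finite acyclic directed multigraph whose channels $e\in E$ have unit capacity, with one source node $s$ without incoming channels, a set $T\subseteq V\setminus\{s\}$ of sink nodes without outgoing channels, and $J=V\setminus(\{s\}\cup T)$ the set of internal nodes. For $t\in T$ let $C_t$ be the minimum cut capacity between $s$ and $t$. Let $\mathcal F$ be a finite field and let $\omega\ge 2$ satisfy $\omega\le C_t$ for all $t\in T$. A $w$-dimensional code on $G$ consists of local encoding coefficients $k_{d,e}\in\mathcal F$ for all adjacent pairs of channels, where $s$ has $w$ imaginary incoming channels $d_1',\dots,d_w'$. The extended global encoding kernels $\tilde f_e\in\mathcal F^{w+|E|}$ are given by $\tilde f_e=\sum_{d\in In(tail(e))}k_{d,e}\tilde f_d+1_e$ for $e\in E$ and $\tilde f_{d_i'}=1_{d_i'}$. For $t\in T$ let $\left[\begin{smallmatrix}F_t\\G_t\end{smallmatrix}\right]=[\tilde f_e:e\in In(t)]$, where $F_t$ has the first $w$ rows. Let $\Phi(t)=\{XF_t:X\in\mathcal F^w\}$ and, for $\rho\subseteq E$, let $\Delta(t,\rho)=\{ZG_t: Z\in\mathcal F^{E},\ Z_e=0\text{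 for }e\notin\rho\}$. Let $rank_t(\rho)$ be the least $|\rho'|$ over all $\rho'\subseteq E$ such that $\Delta(t,\rho)\subseteq\Delta(t,\rho')$ for every code on $G$ over $\mathcal F$ (of any dimension). The code is regular if $\dim\Phi(t)=w$ for all $t\in T$; it is a network MDS code if it is regular and, for every $t\in T$, $$d_{\min}^{(t)}:=\min\{rank_t(\rho):\Delta(t,\rho)\cap\Phi(t)\ne\{0\}\}=C_t-w+1.$$ Random method for the rates $\omega$ and $\omega-1$: all local encoding coefficients $k_{d,e}$ of an $\omega$-dimensional code $\mathbf C_\omega$ and all entries of a vector $(k_1,\dots,k_{\omega-1})\in\mathcal F^{\omega-1}$ are chosen independently and uniformly from $\mathcal F$. The $(\omega-1)$-dimensional code $\mathbf C_{\omega-1}$ has the same local encoding coefficients as $\mathbf C_\omega$ at all non-source nodes, and the coefficients $k_{d_i',e}+k_i\,k_{d_\omega',e}$ ($1\le i\le\omega-1$, $e\in Out(s)$) at the source. Let $P$ be the probability that both $\mathbf C_\omega$ and $\mathbf C_{\omega-1}$ are network MDS codes. (1) If $\sum_{t\in T}\binom{|E|}{C_t-\omega}<|\mathcal F|$, then $$P\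 \ge\ \left[1-\frac{\sum_{t\in T}\binom{|E|}{C_t-\omega+1}}{|\mathcal F|}\right]\cdot\left[1-\frac{\sum_{t\in T}\binom{|E|}{C_t-\omega}}{|\mathcal F|-1}\right]^{|J|+1}.$$ (2) If $C_t\le\lfloor|E|/2\rfloor$ for all $t\in T$ and $\sum_{t\in T}\binom{|E|}{C_t-\omega+1}<|\mathcal F|$, then $$P\ \ge\ \left[1-\frac{\sum_{t\in T}\binom{|E|}{C_t-\omega+1}}{|\mathcal F|-1}\right]^{|J|+2}.$$ -/

import Mathlib

/-- A single source multicast network: a finite acyclic directed multigraph with node set `V` and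
channel set `E` (every channel has unit capacity), a source node without incoming channels and a
set of sink nodes without outgoing channels. -/
structure Network (V E : Type*) where
  tail : E → V
  head : E → V
  source : V
  sinks : Finset V
  source_notMem_sinks : source ∉ sinks
  head_ne_source : ∀ e, head e ≠ source
  tail_notMem_sinks : ∀ e, tail e ∉ sinks
  acyclic : ∀ v, ¬ Relation.TransGen (fun i j => ∃ e, tail e = i ∧ head e = j) v v

namespace Network

theorem wellFounded_adjacent {V E : Type*} [Finite E] (G : Network V E) :
    WellFounded (fun d e : E => G.head d = G.tail e) := by
  have hirr : ∀ e, ¬ Relation.TransGen (fun d e : E => G.head d = G.tail e) e e := by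
    intro e he
    exact G.acyclic (G.tail e) (he.lift G.tail fun a b hab => ⟨a, rfl, hab⟩)
  have : Std.Irrefl (Relation.TransGen (fun d e : E => G.head d = G.tail e)) := ⟨hirr⟩
  have hwf := Finite.wellFounded_of_trans_of_irrefl
    (Relation.TransGen (fun d e : E => G.head d = G.tail e))
  exact hwf.mono fun _ _ h => Relation.TransGen.single h

variable {V E : Type*} [Fintype V] [DecidableEq V] [Fintype E] [DecidableEq E]

/-- The set `J = V - {s} - T` of internal nodes. -/
def internalNodes (G : Network V E) : Finset V :=
  Finset.univ \ insert G.source G.sinks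

/-- The set `A` of channels is a cut between `i` and `j`: its removal disconnects `i` from `j`. -/
def IsCut (G : Network V E) (i j : V) (A : Finset E) : Prop :=
  ¬ Relation.ReflTransGen (fun u v => ∃ e, e ∉ A ∧ G.tail e = u ∧ G.head e = v) i j

/-- The minimum cut capacity `C_t` between the source node and `t`. -/
noncomputable def minCut (G : Network V E) (t : V) : ℕ :=
  sInf {n | ∃ A : Finset E, G.IsCut G.source t A ∧ A.card = n}

/-- The real incoming channels `In(i)`. -/
abbrev In (G : Network V E) (i : V) : Type _ := {e : E // G.head e = i}

/-- The outgoing channels `Out(i)`. -/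
abbrev Out (G : Network V E) (i : V) : Type _ := {e : E // G.tail e = i}

/-- The adjacent pairs `(d, e)` of channels for information rate `w`: either `d` is one of the `w`
imaginary message channels and `e ∈ Out(s)`, or `d`, `e` are channels with `head d = tail e`. -/
abbrev AdjacentPair (G : Network V E) (w : ℕ) : Type _ :=
  (Fin w × G.Out G.source) ⊕ {p : E × E // G.head p.1 = G.tail p.2}

/-- A `w`-dimensional `F`-valued linear network error correction code, by its local description:
a local encoding coefficient `k_{d,e}` for every adjacent pair `(d, e)`. -/
abbrev Code (G : Network V E) (F : Type*) (w : ℕ) : Type _ := G.AdjacentPair w → F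

variable {F : Type*} [Field F] {w : ℕ}

/-- The extended global encoding kernel of the channel `e`, a vector with entries indexed by the
`w` imaginary message channels and by `E`, determined recursively along the acyclic network by
`f_e = ∑_{d ∈ In(tail e)} k_{d,e} f_d + 1_e`, where `f_{d'_i} = 1_{d'_i}` for the imaginary message
channels (which are the only incoming channels of the source node). -/
noncomputable def extKernel (G : Network V E) (c : G.Code F w) : E → (Fin w ⊕ E → F) :=
  G.wellFounded_adjacent.fix fun e f =>
    (if h : G.tail e = G.source then
        ∑ i : Fin w, c (Sum.inl (i, ⟨e, h⟩)) • Pi.single (Sum.inl i) 1 else 0)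
      + ∑ d : G.In (G.tail e), c (Sum.inr ⟨(d.1, e), d.2⟩) • f d.1 d.2
      + Pi.single (Sum.inr e) 1

theorem extKernel_eq (G : Network V E) (c : G.Code F w) (e : E) :
    G.extKernel c e =
      (if h : G.tail e = G.source then
          ∑ i : Fin w, c (Sum.inl (i, ⟨e, h⟩)) • Pi.single (Sum.inl i) 1 else 0)
        + ∑ d : G.In (G.tail e), c (Sum.inr ⟨(d.1, e), d.2⟩) • G.extKernel c d.1
        + Pi.single (Sum.inr e) 1 := by
  unfold extKernel
  rw [WellFounded.fix_eq]

/-- The decoding matrix at `t`, with columns the extended global encoding kernels of the channels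
in `In(t)`. -/
noncomputable def decodingMatrix (G : Network V E) (c : G.Code F w) (t : V) :
    Matrix (Fin w ⊕ E) (G.In t) F :=
  Matrix.of fun r e => G.extKernel c e.1 r

/-- The block `F_t` of the decoding matrix, consisting of the message rows. -/
noncomputable def messageMatrix (G : Network V E) (c : G.Code F w) (t : V) :
    Matrix (Fin w) (G.In t) F :=
  (G.decodingMatrix c t).submatrix Sum.inl id

/-- The block `G_t` of the decoding matrix, consisting of the error rows. -/
noncomputable def errorMatrix (G : Network V E) (c : G.Code F w) (t : V) :
    Matrix E (G.In t) F :=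
  (G.decodingMatrix c t).submatrix Sum.inr id

variable (F) in
/-- The error vectors `Z` that match the error pattern `ρ`. -/
def matching (ρ : Finset E) : Submodule F (E → F) where
  carrier := {Z | ∀ e, e ∉ ρ → Z e = 0}
  add_mem' := by
    intro a b ha hb e he
    simp [ha e he, hb e he]
  zero_mem' := by
    intro e _
    rfl
  smul_mem' := by
    intro r a ha e he
    simp [ha e he]

/-- The error space `Δ(t, ρ) = {Z G_t : Z matches ρ}`. -/
noncomputable def errorSpace (G : Network V E) (c : G.Code F w) (t : V) (ρ : Finset E) :
    Submodule F (G.In t → F) :=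
  (matching F ρ).map (G.errorMatrix c t).vecMulLinear

/-- The message space `Φ(t) = {X F_t : X ∈ F^w}`. -/
noncomputable def messageSpace (G : Network V E) (c : G.Code F w) (t : V) :
    Submodule F (G.In t → F) :=
  LinearMap.range (G.messageMatrix c t).vecMulLinear

variable (F) in
/-- The error pattern `ρ₁` is dominated by `ρ₂` with respect to `t`: `Δ(t, ρ₁) ⊆ Δ(t, ρ₂)` for any
linear network code (of any dimension). -/
def Dominated (G : Network V E) (t : V) (ρ₁ ρ₂ : Finset E) : Prop :=
  ∀ (w : ℕ) (c : G.Code F w), G.errorSpace c t ρ₁ ≤ G.errorSpace c t ρ₂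

variable (F) in
/-- The rank of the error pattern `ρ` with respect to `t`: the least cardinality of an error pattern
that dominates `ρ`. -/
noncomputable def patternRank (G : Network V E) (t : V) (ρ : Finset E) : ℕ :=
  sInf {n | ∃ ρ' : Finset E, G.Dominated F t ρ ρ' ∧ ρ'.card = n}

/-- The code is regular: `dim Φ(t) = w` for every sink node `t`. -/
def IsRegular (G : Network V E) (c : G.Code F w) : Prop :=
  ∀ t ∈ G.sinks, Module.finrank F (G.messageSpace c t) = w

/-- The minimum distance at `t`, that is
`min {rank_t(ρ) : dim (Δ(t, ρ) ∩ Φ(t)) > 0}`. -/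
noncomputable def minDist (G : Network V E) (c : G.Code F w) (t : V) : ℕ :=
  sInf {n | ∃ ρ : Finset E,
    0 < Module.finrank F ↥(G.errorSpace c t ρ ⊓ G.messageSpace c t) ∧ G.patternRank F t ρ = n}

/-- Network MDS codes: regular codes that attain the refined Singleton bound
`d_min = C_t - w + 1` at every sink node. -/
def IsMDS (G : Network V E) (c : G.Code F w) : Prop :=
  G.IsRegular c ∧ ∀ t ∈ G.sinks, G.minDist c t = G.minCut t - w + 1

/-- The code of dimension `m` obtained from a code of dimension `m + 1` and a vector `k ∈ F^m`: all
local encoding coefficients at non-source nodes are kept, and those at the source node become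
`k_{d'_i,e} + k_i k_{d'_{m+1},e}`. -/
def reduce (G : Network V E) {m : ℕ} (c : G.Code F (m + 1)) (k : Fin m → F) : G.Code F m
  | Sum.inl (i, e) => c (Sum.inl (i.castSucc, e)) + k i * c (Sum.inl (Fin.last m, e))
  | Sum.inr p => c (Sum.inr p)

/-- The extended global encoding kernels of the reduced code are the products of the block matrix
`[I k 0; 0 0 I]` with those of the original code. -/
theorem extKernel_reduce (G : Network V E) {m : ℕ} (c : G.Code F (m + 1)) (k : Fin m → F) (e : E) :
    (∀ i, G.extKernel (G.reduce c k) e (Sum.inl i) =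
      G.extKernel c e (Sum.inl i.castSucc) + k i * G.extKernel c e (Sum.inl (Fin.last m))) ∧
    ∀ a, G.extKernel (G.reduce c k) e (Sum.inr a) = G.extKernel c e (Sum.inr a) := by
  induction e using G.wellFounded_adjacent.induction with
  | _ e ih =>
    refine ⟨fun i => ?_, fun a => ?_⟩
    · rw [extKernel_eq, extKernel_eq]
      have h1 : ∀ d : G.In (G.tail e), G.extKernel (G.reduce c k) d.1 (Sum.inl i) = _ :=
        fun d => (ih d.1 d.2).1 i
      by_cases h : G.tail e = G.source
      · simp [h, Finset.sum_apply, h1, reduce, mul_add, Finset.sum_add_distrib, Finset.mul_sum,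
          Pi.single_apply, mul_left_comm]
        ring
      · simp [h, Finset.sum_apply, h1, reduce, mul_add, Finset.sum_add_distrib, Finset.mul_sum,
          mul_left_comm]
    · rw [extKernel_eq, extKernel_eq]
      have h1 : ∀ d : G.In (G.tail e), G.extKernel (G.reduce c k) d.1 (Sum.inr a) = _ :=
        fun d => (ih d.1 d.2).2 a
      by_cases h : G.tail e = G.source <;>
        simp [h, Finset.sum_apply, h1, reduce, Pi.single_apply]

variable (F) in
/-- The success probability of the random method for the rates `m + 1` and `m`. The local encoding
coefficients `k_{d,e}` of the code of dimension `m + 1` and the entries of the vector `k ∈ F^m` are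
independent and uniformly distributed over `F` (that is, their joint law is uniform); the method
succeeds if the code of dimension `m + 1` and its reduction by `k` are both network MDS codes. -/
noncomputable def successProb [Fintype F] (G : Network V E) (m : ℕ) : ℝ :=
  ((PMF.uniformOfFintype (G.Code F (m + 1) × (Fin m → F))).toOuterMeasure
    {x | G.IsMDS x.1 ∧ G.IsMDS (G.reduce x.1 x.2)}).toReal

end Network

/-! A set of channels is linked to `t` when it satisfies the cut condition that, by Menger's
theorem, means it can be joined to In(t) by disjoint paths. A code is generic (`IsGeneric`) if at
each sink the message rows of the decoding matrix, together with the rows of any pattern σ of C_t -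
w channels such that σ and the message channels form a linked set, are independent. The error space
of any pattern of at most C_t - w channels lies in that of such a σ (`exists_linked_card_eq`). So
for a generic code all these error spaces meet the message space trivially, and the code is MDS
(`isMDS_of_disjoint`).

Each single independence condition is satisfied by a routing code
(`exists_linearIndepOn_of_linked`), hence over any field. The coefficients are then drawn node by
node. By acyclicity the kernels depend affinely on the coefficients at one node, and independence is
lost only if a random linear operator has a nonzero fixed vector, which has probability at most
1/(|F| - 1) (`card_exists_fixed_mul_le`). A union bound over the patterns at each of the |J| + 1
nodes with outgoing channels yields the power (`pow_mul_card_le_card_forall`).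

For a generic code of rate ω, reduction by k leaves the error spaces unchanged. The messages of rate
ω whose images lie in the error space of a fixed pattern of C_t - ω + 1 channels span at most a
line, so the bad k for that pattern lie in one affine hyperplane, of density 1/|F|
(`card_not_disjoint_reduce_mul_le`). This gives the remaining factor of (1). Part (2) follows from
(1), as binomial coefficients increase below the middle. -/

set_option linter.unusedSectionVars false

/-! ### Linked sets: submodularity of the boundary and exchange -/

section Boundary

variable {α : Type*} [DecidableEq α]

open Classical in
/-- The elements of `U` that are targets or have a successor outside of `U`. -/
noncomputable def boundary (adj : α → α → Prop) (tgt : α → Prop) (U : Finset α) : Finset α :=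
  U.filter fun a => tgt a ∨ ∃ b, adj a b ∧ b ∉ U

/-- Every set that separates `R` from the targets has at least as many elements as `R`. -/
def Linked (adj : α → α → Prop) (tgt : α → Prop) (R : Finset α) : Prop :=
  ∀ U, R ⊆ U → R.card ≤ (boundary adj tgt U).card

variable {adj : α → α → Prop} {tgt : α → Prop}

theorem mem_boundary {U : Finset α} {a : α} :
    a ∈ boundary adj tgt U ↔ a ∈ U ∧ (tgt a ∨ ∃ b, adj a b ∧ b ∉ U) := by
  simp [boundary]

theorem boundary_subset (U : Finset α) : boundary adj tgt U ⊆ U :=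
  fun _ h => (mem_boundary.1 h).1

/-- Submodularity, which drives the uncrossing arguments: an element of either boundary on the left
lies in one of those on the right, and an element of both on the left lies in both on the right. -/
theorem card_boundary_union_add_card_boundary_inter (U W : Finset α) :
    (boundary adj tgt (U ∪ W)).card + (boundary adj tgt (U ∩ W)).card ≤
      (boundary adj tgt U).card + (boundary adj tgt W).card := by
  rw [← Finset.card_union_add_card_inter, ← Finset.card_union_add_card_inter (boundary adj tgt U)]
  refine add_le_add (Finset.card_le_card fun a => ?_) (Finset.card_le_card fun a => ?_)
  · simp only [Finset.mem_union, mem_boundary, Finset.mem_inter]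
    grind
  · simp only [Finset.mem_union, mem_boundary, Finset.mem_inter]
    grind

theorem Linked.subset {R S : Finset α} (h : Linked adj tgt R) (hS : S ⊆ R) :
    Linked adj tgt S := by
  intro U hU
  have h1 := h (U ∪ (R \ S)) (by intro a ha; by_cases a ∈ S <;> grind)
  have h2 : boundary adj tgt (U ∪ (R \ S)) ⊆ boundary adj tgt U ∪ (R \ S) := by
    intro b
    simp only [mem_boundary, Finset.mem_union]
    grind
  have h3 := (Finset.card_le_card h2).trans (Finset.card_union_le _ _)
  have h4 := Finset.card_sdiff_add_card_eq_card hS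
  omega

/-- Sets containing `R` whose boundary has only |R| elements are closed under union, by
submodularity and the lower bound |R| for the boundary of the intersection. Each element that cannot
be added to `R` lies in such a tight set, so one tight set absorbs them all. -/
theorem Linked.exists_superset {R : Finset α} (h : Linked adj tgt R) (Q : Finset α)
    (hQ : ∀ e ∈ Q, e ∉ R → ¬ Linked adj tgt (insert e R)) :
    ∃ U, R ⊆ U ∧ Q ⊆ U ∧ (boundary adj tgt U).card ≤ R.card := by
  induction Q using Finset.induction_on with
  | empty => exact ⟨R, subset_rfl, by simp, Finset.card_le_card (boundary_subset R)⟩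
  | insert e Q he ih =>
    obtain ⟨U, hRU, hQU, hU⟩ := ih fun f hf => hQ f (Finset.mem_insert_of_mem hf)
    by_cases heR : e ∈ R
    · exact ⟨U, hRU, Finset.insert_subset (hRU heR) hQU, hU⟩
    have h1 := hQ e (Finset.mem_insert_self _ _) heR
    simp only [Linked, not_forall, not_le] at h1
    obtain ⟨W, hW, hWc⟩ := h1
    rw [Finset.card_insert_of_notMem heR] at hWc
    have h2 := card_boundary_union_add_card_boundary_inter (adj := adj) (tgt := tgt) U W
    have h3 := h (U ∩ W) (Finset.subset_inter hRU ((Finset.subset_insert _ _).trans hW))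
    refine ⟨U ∪ W, hRU.trans Finset.subset_union_left, Finset.insert_subset ?_ ?_, by omega⟩
    · exact Finset.mem_union_right _ (hW (Finset.mem_insert_self _ _))
    · exact hQU.trans Finset.subset_union_left

/-- In a linked set, an element that is not a target can be replaced by one of its successors. -/
theorem Linked.exists_replace [Fintype α] {S : Finset α} {r : α} (hr : r ∉ S)
    (h : Linked adj tgt (insert r S)) (ht : ¬ tgt r) :
    ∃ e, adj r e ∧ e ∉ S ∧ Linked adj tgt (insert e S) := by
  classical
  by_contra! hcon
  obtain ⟨U, hSU, hQU, hU⟩ := (h.subset (Finset.subset_insert r S)).exists_superset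
    (Finset.univ.filter (adj r)) fun e he heS => hcon e (by simpa using he) heS
  have h1 := h (insert r U) (Finset.insert_subset_insert _ hSU)
  -- All successors of `r` lie in the tight set `U` and `r` is no target, so adding `r` creates no
  -- new boundary; yet `insert r S` requires one more boundary element than `U` has.
  have h2 : boundary adj tgt (insert r U) ⊆ boundary adj tgt U := by
    intro b
    have : ∀ e, adj r e → e ∈ U := fun e he => hQU (by simpa using he)
    simp only [mem_boundary, Finset.mem_insert]
    grind
  have h3 := Finset.card_le_card h2
  rw [Finset.card_insert_of_notMem hr] at h1
  omega

end Boundary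

/-! ### Kernels as an inverse matrix, and routing codes on linked sets -/

namespace Network

variable {V E : Type*} [Fintype V] [DecidableEq V] [Fintype E] [DecidableEq E]
variable {F : Type*} [Field F] {w : ℕ}

/-- The node at which a channel ends, imaginary message channels ending at the source node. -/
def chanHead (G : Network V E) : Fin w ⊕ E → V :=
  Sum.elim (fun _ => G.source) G.head

/-- The channel `b` leaves the node at which the channel `a` ends. -/
def ChanAdj (G : Network V E) (a b : Fin w ⊕ E) : Prop :=
  ∃ e, b = Sum.inr e ∧ G.chanHead a = G.tail e

/-- The channel `a` is one of the channels in `In(t)`. -/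
def IsInChan (G : Network V E) (t : V) (a : Fin w ⊕ E) : Prop :=
  ∃ e, a = Sum.inr e ∧ G.head e = t


/-- The local encoding coefficient of a pair of channels, zero if the pair is not adjacent. -/
def coef (G : Network V E) (c : G.Code F w) (a : Fin w ⊕ E) (e : E) : F :=
  match a with
  | Sum.inl i => if h : G.tail e = G.source then c (Sum.inl (i, ⟨e, h⟩)) else 0
  | Sum.inr d => if h : G.head d = G.tail e then c (Sum.inr ⟨(d, e), h⟩) else 0

/-- The code with prescribed local encoding coefficients at the adjacent pairs. -/
def toCode (G : Network V E) (g : Fin w ⊕ E → E → F) : G.Code F w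
  | Sum.inl (i, e) => g (Sum.inl i) e.1
  | Sum.inr p => g (Sum.inr p.1.1) p.1.2

/-- The node at which an adjacent pair of channels meets. -/
def pairNode (G : Network V E) (p : G.AdjacentPair w) : V :=
  match p with
  | Sum.inl _ => G.source
  | Sum.inr p => G.tail p.1.2

theorem coef_toCode (G : Network V E) (g : Fin w ⊕ E → E → F) (a : Fin w ⊕ E) (e : E) :
    G.coef (G.toCode g) a e = if G.chanHead a = G.tail e then g a e else 0 := by
  rcases a with i | d
  · by_cases h : G.tail e = G.source <;> simp [coef, toCode, chanHead, h]
    simp [Ne.symm h]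
  · by_cases h : G.head d = G.tail e <;> simp [coef, toCode, chanHead, h]

theorem coef_of_ne (G : Network V E) (c : G.Code F w) {a : Fin w ⊕ E} {e : E}
    (h : G.chanHead a ≠ G.tail e) : G.coef c a e = 0 := by
  rcases a with i | d
  · simp only [chanHead, Sum.elim_inl] at h
    simp [coef, Ne.symm h]
  · simp only [chanHead, Sum.elim_inr] at h
    simp [coef, h]

/-- The matrix of local encoding coefficients, indexed by all pairs of channels. -/
def localMatrix (G : Network V E) (c : G.Code F w) : Matrix (Fin w ⊕ E) (Fin w ⊕ E) F :=
  Matrix.of fun a => Sum.elim 0 (G.coef c a)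

/-- The matrix with columns the extended global encoding kernels of all channels. -/
noncomputable def kernelMatrix (G : Network V E) (c : G.Code F w) :
    Matrix (Fin w ⊕ E) (Fin w ⊕ E) F :=
  Matrix.of fun a => Sum.elim (fun i => (Pi.single (Sum.inl i) 1 : Fin w ⊕ E → F) a)
    (fun e => G.extKernel c e a)

/-- The rows of the decoding matrix at `t`. -/
noncomputable def decodingRow (G : Network V E) (c : G.Code F w) (t : V) (a : Fin w ⊕ E) :
    G.In t → F :=
  fun e => G.extKernel c e.1 a

theorem decodingRow_apply (G : Network V E) (c : G.Code F w) (t : V) (a : Fin w ⊕ E)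
    (e : G.In t) : G.decodingRow c t a e = G.kernelMatrix c a (Sum.inr e.1) := rfl

theorem localMatrix_eq_zero (G : Network V E) (c : G.Code F w) {a b : Fin w ⊕ E}
    (h : ¬ G.ChanAdj a b) : G.localMatrix c a b = 0 := by
  rcases b with i | e
  · simp [localMatrix]
  · simp only [localMatrix, Matrix.of_apply, Sum.elim_inr]
    exact G.coef_of_ne c fun h' => h ⟨e, rfl, h'⟩

theorem kernelMatrix_eq (G : Network V E) (c : G.Code F w) :
    G.kernelMatrix c = 1 + G.kernelMatrix c * G.localMatrix c := by
  ext a b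
  rcases b with i | e
  · simp [kernelMatrix, localMatrix, Matrix.mul_apply, Matrix.one_apply, Pi.single_apply]
  · have h1 : ∑ d : G.In (G.tail e), c (Sum.inr ⟨(d.1, e), d.2⟩) * G.extKernel c d.1 a =
        ∑ d : E, G.extKernel c d a * G.coef c (Sum.inr d) e := by
      have h2 := Finset.sum_subtype (Finset.univ.filter fun d => G.head d = G.tail e)
        (F := inferInstance)
        (p := fun d => G.head d = G.tail e) (fun d => by simp)
        (fun d => G.extKernel c d a * G.coef c (Sum.inr d : Fin w ⊕ E) e)
      rw [Finset.sum_filter] at h2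
      trans ∑ d : E, if G.head d = G.tail e then
        G.extKernel c d a * G.coef c (Sum.inr d : Fin w ⊕ E) e else 0
      · rw [h2]
        refine Finset.sum_congr rfl fun d _ => ?_
        rw [mul_comm]
        simp [coef, d.2]
      · refine Finset.sum_congr rfl fun d _ => ?_
        by_cases h : G.head d = G.tail e <;> simp [h, coef]
    have h3 : (if h : G.tail e = G.source then
        ∑ i : Fin w, c (Sum.inl (i, ⟨e, h⟩)) • (Pi.single (Sum.inl i) 1 : Fin w ⊕ E → F)
          else 0) a =
        ∑ i : Fin w, (Pi.single (Sum.inl i) 1 : Fin w ⊕ E → F) a * G.coef c (Sum.inl i) e := by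
      by_cases h : G.tail e = G.source <;> simp [h, coef, Finset.sum_apply, mul_comm]
    have h4 := congrFun (G.extKernel_eq c e) a
    simp only [Pi.add_apply, h3, Finset.sum_apply, Pi.smul_apply, smul_eq_mul, h1] at h4
    simp only [kernelMatrix, localMatrix, Matrix.add_apply, Matrix.mul_apply, Matrix.of_apply,
      Fintype.sum_sum_type, Sum.elim_inl, Sum.elim_inr]
    rw [h4, Matrix.one_apply, Pi.single_apply]
    ring

theorem kernelMatrix_mul (G : Network V E) (c : G.Code F w) :
    G.kernelMatrix c * (1 - G.localMatrix c) = 1 := by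
  rw [mul_sub, mul_one, sub_eq_iff_eq_add]
  exact G.kernelMatrix_eq c

theorem mul_kernelMatrix (G : Network V E) (c : G.Code F w) :
    (1 - G.localMatrix c) * G.kernelMatrix c = 1 :=
  mul_eq_one_comm.1 (G.kernelMatrix_mul c)

theorem kernelMatrix_eq' (G : Network V E) (c : G.Code F w) :
    G.kernelMatrix c = 1 + G.localMatrix c * G.kernelMatrix c := by
  have := G.mul_kernelMatrix c
  rwa [sub_mul, one_mul, sub_eq_iff_eq_add] at this

/-- The resolvent identity for the inverses of 1 - `localMatrix`. -/
theorem kernelMatrix_sub (G : Network V E) (c c' : G.Code F w) :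
    G.kernelMatrix c' - G.kernelMatrix c =
      G.kernelMatrix c' * (G.localMatrix c' - G.localMatrix c) * G.kernelMatrix c := by
  have h : G.localMatrix c' - G.localMatrix c =
    (1 - G.localMatrix c) - (1 - G.localMatrix c') := by abel
  rw [h, mul_sub, sub_mul, G.kernelMatrix_mul, mul_assoc, G.mul_kernelMatrix, mul_one, one_mul]

/-- The rows of the decoding matrix satisfy a recursion over the outgoing channels. -/
theorem decodingRow_eq (G : Network V E) (c : G.Code F w) (t : V) (a : Fin w ⊕ E) :
    G.decodingRow c t a =
      (fun e : G.In t => if a = Sum.inr e.1 then 1 else 0) +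
        ∑ f : E, G.coef c a f • G.decodingRow c t (Sum.inr f) := by
  ext e
  have h := congrFun (congrFun (G.kernelMatrix_eq' c) a) (Sum.inr e.1)
  simpa [Matrix.mul_apply, Matrix.one_apply, localMatrix, decodingRow_apply] using h

theorem wellFounded_chanAdj (G : Network V E) :
    WellFounded (G.ChanAdj : Fin w ⊕ E → Fin w ⊕ E → Prop) := by
  have h1 : ∀ i : Fin w, Acc (G.ChanAdj (w := w)) (Sum.inl i) := fun i =>
    ⟨_, fun b hb => by obtain ⟨e, he, -⟩ := hb; simp at he⟩
  refine ⟨fun a => ?_⟩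
  rcases a with i | e
  · exact h1 i
  · induction e using G.wellFounded_adjacent.induction with
    | _ e ih =>
      refine ⟨_, fun b hb => ?_⟩
      obtain ⟨f, hf, hb⟩ := hb
      cases hf
      rcases b with i | d
      · exact h1 i
      · exact ih d hb

theorem not_transGen_chanAdj (G : Network V E) (a : Fin w ⊕ E) :
    ¬ Relation.TransGen G.ChanAdj a a :=
  fun h => (G.wellFounded_chanAdj.transGen.irrefl).irrefl a h

theorem wellFounded_flip_chanAdj (G : Network V E) :
    WellFounded (fun a b : Fin w ⊕ E => G.ChanAdj b a) := by
  have : Std.Irrefl (Relation.TransGen (fun a b : Fin w ⊕ E => G.ChanAdj b a)) :=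
    ⟨fun a h => G.not_transGen_chanAdj a (Relation.transGen_swap.1 h)⟩
  exact (Finite.wellFounded_of_trans_of_irrefl
    (Relation.TransGen (fun a b : Fin w ⊕ E => G.ChanAdj b a))).mono
      fun _ _ h => Relation.TransGen.single h

theorem reflTransGen_of_kernelMatrix_ne_zero (G : Network V E) (c : G.Code F w)
    {a b : Fin w ⊕ E} (h : G.kernelMatrix c a b ≠ 0) : Relation.ReflTransGen G.ChanAdj a b := by
  induction b using G.wellFounded_chanAdj.induction with
  | _ b ih =>
    by_cases hab : a = b
    · rw [hab]
    rw [kernelMatrix_eq, Matrix.add_apply, Matrix.one_apply_ne hab, zero_add,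
      Matrix.mul_apply] at h
    obtain ⟨d, -, hd⟩ := Finset.exists_ne_zero_of_sum_ne_zero h
    have hadj : G.ChanAdj d b := by
      by_contra hn
      exact hd (by rw [G.localMatrix_eq_zero c hn, mul_zero])
    exact (ih d hadj (left_ne_zero_of_mul hd)).tail hadj

theorem not_chanAdj_of_isInChan (G : Network V E) {t : V} (ht : t ∈ G.sinks)
    {a b : Fin w ⊕ E} (ha : G.IsInChan t a) : ¬ G.ChanAdj a b := by
  rintro ⟨f, -, hf⟩
  obtain ⟨e, rfl, he⟩ := ha
  simp only [chanHead, Sum.elim_inr] at hf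
  exact G.tail_notMem_sinks f (by rwa [← hf, he])

/-- If `R` is linked to `In(t)`, then some code over `F` makes the rows of `R` of the decoding
matrix at `t` linearly independent. -/
theorem exists_linearIndepOn_of_linked (G : Network V E) {t : V} (ht : t ∈ G.sinks)
    {R : Finset (Fin w ⊕ E)} (hR : Linked G.ChanAdj (G.IsInChan t) R) :
    ∃ c : G.Code F w, LinearIndepOn F (G.decodingRow c t) (R : Set (Fin w ⊕ E)) := by
  classical
  suffices H : ∀ D : Finset (Fin w ⊕ E), (∀ a ∈ D, ∀ b, G.ChanAdj a b → b ∈ D) →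
      ∀ R ⊆ D, Linked G.ChanAdj (G.IsInChan t) R →
      ∃ c : G.Code F w, LinearIndepOn F (G.decodingRow c t) (R : Set (Fin w ⊕ E)) from
    H Finset.univ (by simp) R (Finset.subset_univ R) hR
  intro D
  induction D using Finset.strongInduction with
  | H D ih =>
  intro hD R hRD hR
  by_cases hall : ∀ a ∈ D, G.IsInChan t a
  · refine ⟨0, ?_⟩
    rw [linearIndepOn_finset_iff]
    intro x hx a ha
    obtain ⟨e, rfl, he⟩ := hall a (hRD ha)
    have h1 := congrFun hx ⟨e, he⟩
    have h2 : ∀ b ∈ R, G.decodingRow (0 : G.Code F w) t b ⟨e, he⟩ =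
        if b = Sum.inr e then 1 else 0 := by
      intro b hb
      rw [decodingRow_eq]
      have : ∀ f, G.coef (0 : G.Code F w) b f = 0 := fun f => by
        rcases b with i | d <;> simp [coef]
      simp [this]
    simp only [Finset.sum_apply, Pi.smul_apply, smul_eq_mul, Pi.zero_apply] at h1
    rw [Finset.sum_congr rfl fun b hb => by rw [h2 b hb]] at h1
    simpa [ha] using h1
  push Not at hall
  -- An upstream-most channel outside In(t) has no predecessor in `D`, since channels into the sink
  -- `t` have no successors. Removing it keeps `D` closed under successors and does not affect the
  -- other rows.
  obtain ⟨r, ⟨hrD, hrt⟩, hmin⟩ := G.wellFounded_chanAdj.has_min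
    {a : Fin w ⊕ E | a ∈ D ∧ ¬ G.IsInChan t a} hall
  have hpred : ∀ a ∈ D, ¬ G.ChanAdj a r := fun a ha har =>
    hmin a ⟨ha, fun h => G.not_chanAdj_of_isInChan ht h har⟩ har
  have hD' : ∀ a ∈ D.erase r, ∀ b, G.ChanAdj a b → b ∈ D.erase r := by
    intro a ha b hab
    rw [Finset.mem_erase] at ha ⊢
    refine ⟨?_, hD a ha.2 b hab⟩
    rintro rfl
    exact hpred a ha.2 hab
  by_cases hrR : r ∉ R
  · exact ih _ (Finset.erase_ssubset hrD) hD' R (Finset.subset_erase.2 ⟨hRD, hrR⟩) hR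
  push Not at hrR
  obtain ⟨e', hre, heS, hL⟩ := Linked.exists_replace (S := R.erase r) (Finset.notMem_erase r R)
    (by rwa [Finset.insert_erase hrR]) hrt
  have heD := hD r hrD e' hre
  have her : e' ≠ r := by
    rintro rfl
    exact hpred _ hrD hre
  have hSD : R.erase r ⊆ D.erase r := Finset.erase_subset_erase r hRD
  obtain ⟨c', hc'⟩ := ih _ (Finset.erase_ssubset hrD) hD' (insert e' (R.erase r))
    (Finset.insert_subset (Finset.mem_erase.2 ⟨her, heD⟩) hSD) hL
  obtain ⟨e, rfl, hre⟩ := hre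
  -- Channel `r` is forwarded to `e` alone, so it inherits the row of `e`; independence for `insert
  -- e' (R.erase r)` becomes independence for `R`.
  let c : G.Code F w := G.toCode fun a f => if a = r then (if f = e then 1 else 0) else G.coef c' a f
  have hcr : ∀ f, G.coef c r f = if f = e then 1 else 0 := by
    intro f
    simp only [c, coef_toCode, if_true]
    split_ifs with h1 h2 <;> simp_all
  have hca : ∀ a, a ≠ r → ∀ f, G.coef c a f = G.coef c' a f := by
    intro a ha f
    simp only [c, coef_toCode, ha, if_false]
    split_ifs with h1
    · rfl
    · rw [G.coef_of_ne c' h1]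
  have hrow : ∀ a ∈ D.erase r, G.decodingRow c t a = G.decodingRow c' t a := by
    intro a
    induction a using G.wellFounded_flip_chanAdj.induction with
    | _ a iha =>
      intro ha
      rw [decodingRow_eq, decodingRow_eq]
      congr 1
      refine Finset.sum_congr rfl fun f _ => ?_
      rw [hca a (Finset.ne_of_mem_erase ha)]
      by_cases hf : G.chanHead a = G.tail f
      · rw [iha (Sum.inr f) ⟨f, rfl, hf⟩ (hD' a ha _ ⟨f, rfl, hf⟩)]
      · rw [G.coef_of_ne c' hf, zero_smul, zero_smul]
  have hrowr : G.decodingRow c t r = G.decodingRow c' t (Sum.inr e) := by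
    rw [decodingRow_eq]
    have h0 : (fun e : G.In t => if r = Sum.inr e.1 then (1 : F) else 0) = 0 := by
      funext f
      exact if_neg fun h => hrt ⟨f.1, h, f.2⟩
    rw [h0, zero_add, ← hrow _ (Finset.mem_erase.2 ⟨her, heD⟩)]
    simp [hcr]
  refine ⟨c, ?_⟩
  rw [← Finset.insert_erase hrR, Finset.coe_insert, linearIndepOn_insert (by simp)]
  rw [Finset.coe_insert, linearIndepOn_insert fun h => heS (Finset.mem_coe.1 h)] at hc'
  have heq : Set.EqOn (G.decodingRow c' t) (G.decodingRow c t) (R.erase r : Finset _) :=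
    fun a ha => (hrow a (hSD ha)).symm
  exact ⟨hc'.1.congr heq, by rw [hrowr, ← heq.image_eq]; exact hc'.2⟩

/-- The rows of a set of channels are combinations of those of its boundary. -/
theorem decodingRow_mem_span_boundary (G : Network V E) (c : G.Code F w) (t : V)
    (U : Finset (Fin w ⊕ E)) (a : Fin w ⊕ E) (ha : a ∈ U) :
    G.decodingRow c t a ∈ Submodule.span F (G.decodingRow c t ''
      (boundary G.ChanAdj (G.IsInChan t) U : Finset (Fin w ⊕ E))) := by
  induction a using G.wellFounded_flip_chanAdj.induction with
  | _ a ih =>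
    by_cases hb : a ∈ boundary G.ChanAdj (G.IsInChan t) U
    · exact Submodule.subset_span ⟨a, hb, rfl⟩
    simp only [mem_boundary, not_and, not_or, not_exists, not_not] at hb
    obtain ⟨hb1, hb2⟩ := hb ha
    rw [decodingRow_eq]
    have h0 : (fun e : G.In t => if a = Sum.inr e.1 then (1 : F) else 0) = 0 := by
      funext f
      exact if_neg fun h => hb1 ⟨f.1, h, f.2⟩
    rw [h0, zero_add]
    refine Submodule.sum_mem _ fun f _ => ?_
    by_cases hf : G.chanHead a = G.tail f
    · exact Submodule.smul_mem _ _ (ih _ ⟨f, rfl, hf⟩ (hb2 _ ⟨f, rfl, hf⟩))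
    · rw [G.coef_of_ne c hf, zero_smul]
      exact Submodule.zero_mem _

/-- The real channels of the boundary form a cut: a path from the source avoiding them uses only
channels of `U` and cannot end at `t`. -/
theorem minCut_le_card_boundary (G : Network V E) {t : V} (ht : t ∈ G.sinks)
    (U : Finset (Fin w ⊕ E)) (hU : ∀ e, G.tail e = G.source → Sum.inr e ∈ U) :
    G.minCut t ≤ (boundary G.ChanAdj (G.IsInChan t) U).card := by
  classical
  set B := boundary G.ChanAdj (G.IsInChan t) U with hB
  have hcut : G.IsCut G.source t B.toRight := by
    intro hpath
    have key : ∀ v, Relation.ReflTransGen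
        (fun u v => ∃ e, e ∉ B.toRight ∧ G.tail e = u ∧ G.head e = v) G.source v →
        v ≠ t ∧ ∀ f, G.tail f = v → (Sum.inr f : Fin w ⊕ E) ∈ U := by
      intro v hv
      induction hv with
      | refl => exact ⟨fun h => G.source_notMem_sinks (h ▸ ht), hU⟩
      | tail _ hstep ih =>
        obtain ⟨e, heB, rfl, rfl⟩ := hstep
        have heU := ih.2 e rfl
        simp only [Finset.mem_toRight, hB, mem_boundary, not_and, not_or, not_exists,
          not_not] at heB
        obtain ⟨h1, h2⟩ := heB heU
        exact ⟨fun h => h1 ⟨e, rfl, h⟩, fun f hf => h2 _ ⟨f, rfl, hf.symm⟩⟩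
    exact (key t hpath).1 rfl
  have hle : G.minCut t ≤ B.toRight.card := Nat.sInf_le ⟨B.toRight, hcut, rfl⟩
  rw [← Finset.card_toLeft_add_card_toRight (u := B)]
  omega

theorem exists_isCut_card_eq_minCut (G : Network V E) {t : V} (ht : t ∈ G.sinks) :
    ∃ A : Finset E, G.IsCut G.source t A ∧ A.card = G.minCut t := by
  refine Nat.sInf_mem (s := {n | ∃ A : Finset E, G.IsCut G.source t A ∧ A.card = n})
    ⟨_, Finset.univ, ?_, rfl⟩
  intro h
  rcases Relation.ReflTransGen.cases_head h with h | ⟨_, ⟨e, he, -⟩, -⟩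
  · exact G.source_notMem_sinks (h ▸ ht)
  · exact he (Finset.mem_univ e)

theorem minCut_le_card (G : Network V E) {t : V} (ht : t ∈ G.sinks) :
    G.minCut t ≤ Fintype.card E := by
  obtain ⟨A, -, hA⟩ := G.exists_isCut_card_eq_minCut ht
  exact hA ▸ Finset.card_le_univ A

/-! ### Message and error spaces, and a criterion for the MDS property -/

theorem messageSpace_eq_span (G : Network V E) (c : G.Code F w) (t : V) :
    G.messageSpace c t = Submodule.span F (G.decodingRow c t '' Set.range Sum.inl) := by
  rw [messageSpace, range_vecMulLinear, ← Set.range_comp]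
  rfl

theorem vecMul_errorMatrix (G : Network V E) (c : G.Code F w) (t : V) (Z : E → F) :
    Matrix.vecMul Z (G.errorMatrix c t) = ∑ e, Z e • G.decodingRow c t (Sum.inr e) :=
  Matrix.vecMul_eq_sum _ _

theorem vecMul_messageMatrix (G : Network V E) (c : G.Code F w) (t : V) (X : Fin w → F) :
    Matrix.vecMul X (G.messageMatrix c t) = ∑ i, X i • G.decodingRow c t (Sum.inl i) :=
  Matrix.vecMul_eq_sum _ _

theorem mem_errorSpace (G : Network V E) (c : G.Code F w) (t : V) (ρ : Finset E)
    (y : G.In t → F) : y ∈ G.errorSpace c t ρ ↔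
      ∃ Z : E → F, (∀ e, e ∉ ρ → Z e = 0) ∧ Matrix.vecMul Z (G.errorMatrix c t) = y :=
  Iff.rfl

theorem errorSpace_eq_span (G : Network V E) (c : G.Code F w) (t : V) (ρ : Finset E) :
    G.errorSpace c t ρ = Submodule.span F (G.decodingRow c t '' (Sum.inr '' (ρ : Set E))) := by
  apply le_antisymm
  · rintro _ ⟨Z, hZ, rfl⟩
    rw [Matrix.vecMulLinear_apply, vecMul_errorMatrix]
    refine Submodule.sum_mem _ fun e _ => ?_
    by_cases he : e ∈ ρ
    · exact Submodule.smul_mem _ _ (Submodule.subset_span ⟨_, ⟨e, he, rfl⟩, rfl⟩)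
    · rw [hZ e he, zero_smul]
      exact Submodule.zero_mem _
  · rw [Submodule.span_le]
    rintro _ ⟨_, ⟨e, he, rfl⟩, rfl⟩
    refine ⟨Pi.single e 1, fun f hf => Pi.single_eq_of_ne (fun h => hf (by rwa [h])) _, ?_⟩
    rw [Matrix.vecMulLinear_apply, vecMul_errorMatrix]
    simp [Pi.single_apply]

theorem errorSpace_mono (G : Network V E) (c : G.Code F w) (t : V) {ρ σ : Finset E}
    (h : ρ ⊆ σ) : G.errorSpace c t ρ ≤ G.errorSpace c t σ :=
  Submodule.map_mono fun _ hZ e he => hZ e fun h' => he (h h')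

theorem errorSpace_union (G : Network V E) (c : G.Code F w) (t : V) (ρ σ : Finset E) :
    G.errorSpace c t (ρ ∪ σ) = G.errorSpace c t ρ ⊔ G.errorSpace c t σ := by
  simp only [errorSpace_eq_span, Finset.coe_union, Set.image_union, Submodule.span_union]

theorem finrank_errorSpace_le (G : Network V E) (c : G.Code F w) (t : V) (ρ : Finset E) :
    Module.finrank F (G.errorSpace c t ρ) ≤ ρ.card := by
  classical
  have h := finrank_span_finset_le_card (R := F)
    (ρ.image fun e => G.decodingRow c t (Sum.inr e))
  rw [Finset.coe_image] at h
  rw [errorSpace_eq_span, Set.image_image]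
  exact h.trans Finset.card_image_le

/-- A cut between the source node and `t` carries the whole message space at `t`. -/
theorem messageSpace_le_errorSpace (G : Network V E) (c : G.Code F w) {t : V} {A : Finset E}
    (hA : G.IsCut G.source t A) : G.messageSpace c t ≤ G.errorSpace c t A := by
  classical
  -- The channels whose tail is reachable from the source off `A`, and all message channels. As `A`
  -- is a cut, the boundary of this set lies in `A`.
  let U : Finset (Fin w ⊕ E) := Finset.univ.filter fun a => Relation.ReflTransGen
    (fun u v => ∃ e, e ∉ A ∧ G.tail e = u ∧ G.head e = v) G.source
      (a.elim (fun _ => G.source) G.tail)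
  have hU : ∀ a ∈ boundary G.ChanAdj (G.IsInChan t) U, ∃ e ∈ A, a = Sum.inr e := by
    intro a ha
    rw [mem_boundary] at ha
    obtain ⟨haU, ha⟩ := ha
    rcases a with i | e
    · exfalso
      rcases ha with ⟨e, he, -⟩ | ⟨_, ⟨f, rfl, hf⟩, hfU⟩
      · cases he
      · refine hfU ?_
        simp only [chanHead, Sum.elim_inl] at hf
        simp only [U, Finset.mem_filter, Finset.mem_univ, true_and, Sum.elim_inr, ← hf]
        exact Relation.ReflTransGen.refl
    · refine ⟨e, ?_, rfl⟩
      by_contra heA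
      simp only [U, Finset.mem_filter, Finset.mem_univ, true_and, Sum.elim_inr] at haU
      have hreach := haU.tail ⟨e, heA, rfl, rfl⟩
      rcases ha with ⟨e', he, het⟩ | ⟨_, ⟨f, rfl, hf⟩, hfU⟩
      · cases he
        exact hA (het ▸ hreach)
      · refine hfU ?_
        simp only [chanHead, Sum.elim_inr] at hf
        simpa only [U, Finset.mem_filter, Finset.mem_univ, true_and, Sum.elim_inr, ← hf] using hreach
  rw [messageSpace_eq_span, errorSpace_eq_span, Submodule.span_le]
  rintro _ ⟨_, ⟨i, rfl⟩, rfl⟩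
  refine Submodule.span_mono (Set.image_mono ?_) (G.decodingRow_mem_span_boundary c t U _ ?_)
  · intro a ha
    obtain ⟨e, he, rfl⟩ := hU a ha
    exact ⟨e, he, rfl⟩
  · simp only [U, Finset.mem_filter, Finset.mem_univ, true_and, Sum.elim_inl]
    exact Relation.ReflTransGen.refl

theorem finrank_messageSpace (G : Network V E) (c : G.Code F w) (t : V)
    (h : ∀ X, Matrix.vecMul X (G.messageMatrix c t) = 0 → X = 0) :
    Module.finrank F (G.messageSpace c t) = w := by
  rw [messageSpace, LinearMap.finrank_range_of_inj]
  · simp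
  · rw [← LinearMap.ker_eq_bot, LinearMap.ker_eq_bot']
    exact h

/-- A regular code is a network MDS code if the error patterns of cardinality at most `C_t - w`
have error spaces disjoint from the message space. -/
theorem isMDS_of_disjoint (G : Network V E) (c : G.Code F w) (hw : 1 ≤ w)
    (hcut : ∀ t ∈ G.sinks, w ≤ G.minCut t) (hreg : G.IsRegular c)
    (h : ∀ t ∈ G.sinks, ∀ ρ : Finset E, ρ.card ≤ G.minCut t - w →
      Disjoint (G.errorSpace c t ρ) (G.messageSpace c t)) : G.IsMDS c := by
  refine ⟨hreg, fun t ht => ?_⟩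
  have hC := hcut t ht
  obtain ⟨A, hA, hAc⟩ := G.exists_isCut_card_eq_minCut ht
  obtain ⟨ρ, hρA, hρ⟩ := Finset.exists_subset_card_eq
    (show G.minCut t - w + 1 ≤ A.card by omega)
  -- Both spaces lie in the error space of the minimum cut `A`, of dimension at most that of Δ(t, ρ)
  -- plus |A \ ρ| = w - 1, while the message space has dimension w. This `ρ` gives the upper bound
  -- and also shows that the infimum defining `minDist` is over a nonempty set.
  have h1 : 0 < Module.finrank F ↥(G.errorSpace c t ρ ⊓ G.messageSpace c t) := by
    have h2 := Submodule.finrank_sup_add_finrank_inf_eq (G.errorSpace c t ρ) (G.messageSpace c t)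
    have h3 : G.errorSpace c t ρ ⊔ G.messageSpace c t ≤ G.errorSpace c t A :=
      sup_le (G.errorSpace_mono c t hρA) (G.messageSpace_le_errorSpace c hA)
    have h4 := Submodule.finrank_mono h3
    have h5 : G.errorSpace c t A = G.errorSpace c t ρ ⊔ G.errorSpace c t (A \ ρ) := by
      rw [← errorSpace_union, Finset.union_sdiff_of_subset hρA]
    rw [h5] at h4
    have h6 := Submodule.finrank_add_le_finrank_add_finrank (G.errorSpace c t ρ)
      (G.errorSpace c t (A \ ρ))
    have h7 := G.finrank_errorSpace_le c t (A \ ρ)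
    rw [Finset.card_sdiff_of_subset hρA, hρ, hAc] at h7
    have h8 := hreg t ht
    omega
  have h2 : G.patternRank F t ρ ≤ G.minCut t - w + 1 :=
    Nat.sInf_le ⟨ρ, fun _ _ => le_rfl, hρ⟩
  apply le_antisymm
  · have h3 : G.minDist c t ≤ G.patternRank F t ρ := Nat.sInf_le ⟨ρ, h1, rfl⟩
    exact h3.trans h2
  · refine le_csInf ⟨_, ρ, h1, rfl⟩ ?_
    rintro _ ⟨σ, hσ, rfl⟩
    by_contra! hlt
    -- A pattern of rank at most C_t - w may be replaced by a dominating one of that cardinality, to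
    -- which the disjointness hypothesis applies.
    obtain ⟨σ', hdom, hcard⟩ := Nat.sInf_mem
      (s := {n | ∃ ρ' : Finset E, G.Dominated F t σ ρ' ∧ ρ'.card = n}) ⟨_, σ, fun _ _ => le_rfl, rfl⟩
    have hcard' : σ'.card = G.patternRank F t σ := hcard
    have hd := (h t ht σ' (by omega)).mono_left (hdom w c)
    rw [hd.eq_bot] at hσ
    simp at hσ

/-! ### Replacing error patterns by linked ones of prescribed size -/

theorem boundary_disjSum_union_subset (G : Network V E) {t : V} (U W : Finset E)
    (h : boundary G.ChanAdj (G.IsInChan t) ((∅ : Finset (Fin w)).disjSum U) ⊆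
      (∅ : Finset (Fin w)).disjSum W) :
    boundary G.ChanAdj (G.IsInChan t) ((∅ : Finset (Fin w)).disjSum (U ∪ W)) ⊆
      boundary G.ChanAdj (G.IsInChan t) ((∅ : Finset (Fin w)).disjSum W) := by
  intro a ha
  rw [mem_boundary] at ha
  obtain ⟨haU, ha⟩ := ha
  rcases a with i | e
  · simp at haU
  have hsucc : ∀ S ⊆ U ∪ W, G.IsInChan t (Sum.inr e : Fin w ⊕ E) ∨
      ∃ b : Fin w ⊕ E, G.ChanAdj (Sum.inr e) b ∧ b ∉ (∅ : Finset (Fin w)).disjSum S := by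
    intro S hS
    refine ha.imp_right ?_
    rintro ⟨b, hb, hbU⟩
    refine ⟨b, hb, fun hbS => hbU ?_⟩
    exact Finset.disjSum_mono subset_rfl hS hbS
  -- A boundary element of the union that comes from `U` is a boundary element of `U`, hence in `W`
  -- by hypothesis.
  have heW : e ∈ W := by
    rcases Finset.mem_union.1 (Finset.inr_mem_disjSum.1 haU) with heU | heW
    · refine Finset.inr_mem_disjSum.1 (h (mem_boundary.2
        ⟨Finset.inr_mem_disjSum.2 heU, hsucc U Finset.subset_union_left⟩))
    · exact heW
  exact mem_boundary.2 ⟨Finset.inr_mem_disjSum.2 heW, hsucc W Finset.subset_union_right⟩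

/-- Every error pattern `ρ` is dominated by a pattern `σ` with at most as many channels that,
together with all message channels, is linked to `In(t)`. -/
theorem exists_linked_of_card_le (G : Network V E) {t : V} (ht : t ∈ G.sinks) (ρ : Finset E)
    (hρ : w + ρ.card ≤ G.minCut t) :
    ∃ σ : Finset E, σ.card ≤ ρ.card ∧
      (∀ c : G.Code F w, G.errorSpace c t ρ ≤ G.errorSpace c t σ) ∧
      Linked G.ChanAdj (G.IsInChan t) ((Finset.univ : Finset (Fin w)).disjSum σ) := by
  classical
  let bd : Finset E → Finset (Fin w ⊕ E) := fun U =>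
    boundary G.ChanAdj (G.IsInChan t) ((∅ : Finset (Fin w)).disjSum U)
  -- The boundary of a set `U` ⊇ `ρ` with smallest boundary serves as σ: its rows span those of `ρ`,
  -- and minimality makes it linked.
  obtain ⟨U, hU, hmin⟩ := Finset.exists_min_image (Finset.univ.filter fun U => ρ ⊆ U)
    (fun U => (bd U).card) ⟨ρ, by simp⟩
  simp only [Finset.mem_filter, Finset.mem_univ, true_and] at hU hmin
  have hbd : bd U = (∅ : Finset (Fin w)).disjSum (bd U).toRight := by
    ext a
    rcases a with i | e
    · simp only [Finset.inl_mem_disjSum, Finset.notMem_empty, iff_false]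
      intro h
      simpa using boundary_subset _ h
    · simp
  have hcard : (bd U).card = (bd U).toRight.card := by
    conv_lhs => rw [hbd]
    simp
  have hρcard : (bd U).card ≤ ρ.card := by
    refine (hmin ρ subset_rfl).trans ((Finset.card_le_card (boundary_subset _)).trans ?_)
    simp
  refine ⟨(bd U).toRight, hcard ▸ hρcard, fun c => ?_, fun W hW => ?_⟩
  · rw [errorSpace_eq_span, errorSpace_eq_span, Submodule.span_le]
    rintro _ ⟨_, ⟨e, he, rfl⟩, rfl⟩
    refine Submodule.span_mono (Set.image_mono ?_)
      (G.decodingRow_mem_span_boundary c t ((∅ : Finset (Fin w)).disjSum U) (Sum.inr e)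
        (Finset.inr_mem_disjSum.2 (hU he)))
    intro a ha
    change a ∈ bd U at ha
    rw [hbd] at ha
    obtain ⟨x, hx, -⟩ | ⟨x, hx, rfl⟩ := Finset.mem_disjSum.1 ha
    · simp at hx
    · exact ⟨x, hx, rfl⟩
  · rw [Finset.card_disjSum, Finset.card_univ, Fintype.card_fin, ← hcard]
    -- If `W` contains every channel leaving the source, its boundary is at least the minimum cut.
    -- Otherwise all `w` message channels are in the boundary, and minimality of `U` against `U ∪
    -- W.toRight` accounts for the real ones.
    by_cases hs : ∀ e, G.tail e = G.source → (Sum.inr e : Fin w ⊕ E) ∈ W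
    · have := G.minCut_le_card_boundary ht W hs
      omega
    push Not at hs
    obtain ⟨f, hf, hfW⟩ := hs
    rw [← Finset.card_toLeft_add_card_toRight (u := boundary G.ChanAdj (G.IsInChan t) W)]
    refine add_le_add ?_ ?_
    · have : (boundary G.ChanAdj (G.IsInChan t) W).toLeft = Finset.univ := by
        ext i
        simp only [Finset.mem_toLeft, Finset.mem_univ, iff_true, mem_boundary]
        exact ⟨hW (by simp), Or.inr ⟨_, ⟨f, rfl, by simp [chanHead, hf]⟩, hfW⟩⟩
      simp [this]
    · have h1 : bd U ⊆ (∅ : Finset (Fin w)).disjSum W.toRight := by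
        rw [hbd]
        refine Finset.disjSum_mono subset_rfl fun e he => ?_
        exact Finset.mem_toRight.2 (hW (Finset.inr_mem_disjSum.2 he))
      have h2 := hmin (U ∪ W.toRight) (hU.trans Finset.subset_union_left)
      refine h2.trans ((Finset.card_le_card (G.boundary_disjSum_union_subset U W.toRight h1)).trans ?_)
      have h3 : boundary G.ChanAdj (G.IsInChan t) ((∅ : Finset (Fin w)).disjSum W.toRight) ⊆
          (∅ : Finset (Fin w)).disjSum (boundary G.ChanAdj (G.IsInChan t) W).toRight := by
        intro a ha
        rw [mem_boundary] at ha
        obtain ⟨haW, ha⟩ := ha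
        rcases a with i | e
        · simp at haW
        refine Finset.inr_mem_disjSum.2 (Finset.mem_toRight.2 (mem_boundary.2 ⟨by simpa using haW,
          ha.imp_right ?_⟩))
        rintro ⟨_, ⟨g, rfl, hg⟩, hgW⟩
        exact ⟨_, ⟨g, rfl, hg⟩, by simpa using hgW⟩
      exact (Finset.card_le_card h3).trans (by simp)

/-- If no channel could be added, a tight set would contain all channels leaving the source, and its
boundary of at most w + |ρ| < C_t elements would beat the minimum cut. -/
theorem exists_linked_of_card_add_le (G : Network V E) {t : V} (ht : t ∈ G.sinks) (n : ℕ)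
    (ρ : Finset E) (hρ : w + (ρ.card + n) ≤ G.minCut t)
    (hL : Linked G.ChanAdj (G.IsInChan t) ((Finset.univ : Finset (Fin w)).disjSum ρ)) :
    ∃ σ : Finset E, ρ ⊆ σ ∧ σ.card = ρ.card + n ∧
      Linked G.ChanAdj (G.IsInChan t) ((Finset.univ : Finset (Fin w)).disjSum σ) := by
  classical
  induction n generalizing ρ with
  | zero => exact ⟨ρ, subset_rfl, rfl, hL⟩
  | succ n ih =>
    have hex : ∃ e ∉ ρ, Linked G.ChanAdj (G.IsInChan t)
        ((Finset.univ : Finset (Fin w)).disjSum (insert e ρ)) := by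
      by_contra! hcon
      obtain ⟨U, -, hQU, hU⟩ := hL.exists_superset
        ((∅ : Finset (Fin w)).disjSum (Finset.univ.filter fun e => G.tail e = G.source)) (by
          intro a ha haR
          rcases a with i | e
          · simp at ha
          · have h1 : insert (Sum.inr e) ((Finset.univ : Finset (Fin w)).disjSum ρ) =
                (Finset.univ : Finset (Fin w)).disjSum (insert e ρ) := by
              ext a
              rcases a with i | f <;> simp
            rw [h1]
            exact hcon e fun h => haR (Finset.inr_mem_disjSum.2 h))
      have h2 := G.minCut_le_card_boundary ht U fun e he => hQU (by simpa using he)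
      rw [Finset.card_disjSum, Finset.card_univ, Fintype.card_fin] at hU
      omega
    obtain ⟨e, he, hLe⟩ := hex
    have hc := Finset.card_insert_of_notMem he
    obtain ⟨σ, h1, h2, h3⟩ := ih (insert e ρ) (by omega) hLe
    exact ⟨σ, (Finset.subset_insert e ρ).trans h1, by omega, h3⟩

/-- Every error pattern of cardinality at most `δ ≤ C_t - w` is dominated by one of cardinality `δ`
that, together with all message channels, is linked to `In(t)`. -/
theorem exists_linked_card_eq (G : Network V E) {t : V} (ht : t ∈ G.sinks) {δ : ℕ}
    (hδ : w + δ ≤ G.minCut t) (ρ : Finset E) (hρ : ρ.card ≤ δ) :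
    ∃ σ : Finset E, σ.card = δ ∧
      (∀ c : G.Code F w, G.errorSpace c t ρ ≤ G.errorSpace c t σ) ∧
      Linked G.ChanAdj (G.IsInChan t) ((Finset.univ : Finset (Fin w)).disjSum σ) := by
  obtain ⟨σ, hσ, hle, hL⟩ := G.exists_linked_of_card_le (F := F) ht ρ (by omega : w + ρ.card ≤ _)
  obtain ⟨τ, h1, h2, h3⟩ := G.exists_linked_of_card_add_le ht (δ - σ.card) σ (by omega) hL
  exact ⟨τ, by omega, fun c => (hle c).trans (G.errorSpace_mono c t h1), h3⟩

end Network

/-! ### Counting: random fixed vectors and blockwise resampling -/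

section Counting

open Classical in
-- Translating the fibre over `y` by a preimage of each `z ∈ W` gives disjoint copies of it, the
-- fibres over y + z.
theorem card_fiber_mul_card_le {K Y : Type*} [AddCommGroup K] [Fintype K] [AddCommGroup Y]
    (f : K →+ Y) (y : Y) (W : Finset Y) (h : ∀ z ∈ W, ∃ k, f k = z) :
    (Finset.univ.filter fun k => f k = y).card * W.card ≤ Fintype.card K := by
  choose! g hg using h
  rw [← Finset.card_product, ← Finset.card_univ]
  refine Finset.card_le_card_of_injOn (fun p => p.1 + g p.2) (fun _ _ => Finset.mem_coe.2 (Finset.mem_univ _)) ?_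
  rintro ⟨k, z⟩ hk ⟨k', z'⟩ hk' heq
  simp only [Finset.coe_product, Set.mem_prod, Finset.mem_coe, Finset.mem_filter,
    Finset.mem_univ, true_and] at hk hk'
  dsimp only at heq
  have h1 := congrArg f heq
  rw [map_add, map_add, hk.1, hk'.1, hg z hk.2, hg z' hk'.2] at h1
  have hz : z = z' := add_left_cancel h1
  subst hz
  rw [add_right_cancel heq]

open Classical in
/-- First moment bound for the probability that a random member of a linear family of operators
has a nonzero fixed vector. -/
theorem card_exists_fixed_mul_le {F K Y : Type*} [Field F] [Fintype F] [AddCommGroup K]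
    [Module F K] [Fintype K] [AddCommGroup Y] [Module F Y] [Fintype Y]
    (B : Y →ₗ[F] K →ₗ[F] Y) (W : Submodule F Y) (hB : ∀ y k, B y k ∈ W)
    (hsurj : ∀ y ∈ W, y ≠ 0 → ∀ z ∈ W, ∃ k, B y k = z) (bad : Finset K)
    (hbad : ∀ k ∈ bad, ∃ y, y ≠ 0 ∧ B y k = y) :
    bad.card * (Fintype.card F - 1) ≤ Fintype.card K := by
  set Wf : Finset Y := Finset.univ.filter (· ∈ W) with hWf
  have hpos : 0 < Wf.card := Finset.card_pos.2 ⟨0, by simp [hWf]⟩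
  -- The |F| - 1 nonzero multiples of a fixed vector are fixed as well; this is the source of the
  -- denominator |F| - 1.
  have h1 : bad.card * (Fintype.card F - 1) ≤
      ∑ k ∈ bad, ((Wf.erase 0).filter fun y => B y k = y).card := by
    rw [← smul_eq_mul]
    refine Finset.card_nsmul_le_sum _ _ _ fun k hk => ?_
    obtain ⟨y, hy, hyk⟩ := hbad k hk
    rw [← Fintype.card_units, ← Finset.card_univ]
    refine Finset.card_le_card_of_injOn (fun a : Fˣ => (a : F) • y) ?_ ?_
    · intro a _
      have hay : (a : F) • y ∈ W := W.smul_mem _ (hyk ▸ hB y k)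
      simp [hWf, hay, hy, hyk]
    · intro a _ b _ hab
      exact Units.ext (smul_left_injective F hy hab)
  have h2 : ∑ k ∈ bad, ((Wf.erase 0).filter fun y => B y k = y).card ≤
      ∑ y ∈ Wf.erase 0, (Finset.univ.filter fun k => B y k = y).card := by
    refine (Finset.sum_le_sum_of_subset (Finset.subset_univ bad)).trans (le_of_eq ?_)
    exact Finset.sum_card_bipartiteAbove_eq_sum_card_bipartiteBelow fun k y => B y k = y
  -- For each nonzero `y ∈ W` the map `B y` hits all of `W`, so at most |K| / |W| parameters fix
  -- `y`.
  have h3 : (∑ y ∈ Wf.erase 0, (Finset.univ.filter fun k => B y k = y).card) * Wf.card ≤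
      (Wf.card - 1) * Fintype.card K := by
    rw [Finset.sum_mul, ← Finset.card_erase_of_mem (show (0 : Y) ∈ Wf by simp [hWf]),
      ← smul_eq_mul]
    refine Finset.sum_le_card_nsmul _ _ _ fun y hy => ?_
    rw [Finset.mem_erase] at hy
    refine card_fiber_mul_card_le (B y).toAddMonoidHom y Wf fun z hz => ?_
    exact hsurj y (by simpa [hWf] using hy.2) hy.1 z (by simpa [hWf] using hz)
  have h4 : (Wf.card - 1) * Fintype.card K ≤ Fintype.card K * Wf.card := by
    rw [mul_comm]
    exact Nat.mul_le_mul_left _ (Nat.sub_le _ _)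
  exact (h1.trans h2).trans (Nat.le_of_mul_le_mul_right (h3.trans h4) hpos)

variable {P β V : Type*} [DecidableEq V]

/-- Replace the values of `c` by those of `k` at all indices belonging to `v`. -/
def resample (node : P → V) (v : V) (c k : P → β) : P → β :=
  fun p => if node p = v then k p else c p

/-- Each of the events `Good i`, `i ∈ I`, is satisfied by a configuration that agrees with `c` on
the blocks of `S`. -/
def IsExtendable (node : P → V) {ι : Type*} (I : Finset ι) (Good : ι → (P → β) → Prop)
    (S : Finset V) (c : P → β) : Prop :=
  ∀ i ∈ I, ∃ c', (∀ p, node p ∈ S → c' p = c p) ∧ Good i c'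

open Classical in
/-- If each of finitely many satisfiable events survives the resampling of any single block of
coordinates with probability at least `1 - ε`, then with `n` blocks they hold simultaneously with
probability at least `(1 - |I| ε) ^ n`. -/
theorem pow_mul_card_le_card_forall [Fintype (P → β)] (node : P → V) {ι : Type*}
    (I : Finset ι) (Good : ι → (P → β) → Prop) (ε : ℝ)
    (hex : ∀ i ∈ I, ∃ c, Good i c)
    (hstep : ∀ i ∈ I, ∀ c, Good i c → ∀ v,
      ((Finset.univ.filter fun k => ¬ Good i (resample node v c k)).card : ℝ) ≤
        ε * Fintype.card (P → β))
    (hε : I.card * ε ≤ 1) (S : Finset V) :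
    (1 - I.card * ε) ^ S.card * Fintype.card (P → β) ≤
      (Finset.univ.filter fun c : P → β => IsExtendable node I Good S c).card := by
  induction S using Finset.induction_on with
  | empty =>
    refine (le_of_eq ?_).trans (Nat.cast_le.2 (Finset.card_le_card (s := Finset.univ)
      fun c _ => Finset.mem_filter.2 ⟨Finset.mem_univ _, fun i hi => ?_⟩))
    · simp
    · obtain ⟨c', hc'⟩ := hex i hi
      exact ⟨c', by simp, hc'⟩
  | insert v S hv ih =>
    set N : ℝ := (Fintype.card (P → β) : ℝ) with hN
    rcases isEmpty_or_nonempty (P → β) with hemp | hne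
    · have hN0 : N = 0 := by rw [hN, Fintype.card_eq_zero]; simp
      rw [hN0, mul_zero]
      positivity
    have hNpos : 0 < N := by rw [hN]; exact_mod_cast Fintype.card_pos
    set A := Finset.univ.filter fun c : P → β => IsExtendable node I Good S c with hA
    set A' := Finset.univ.filter fun c : P → β =>
      IsExtendable node I Good (insert v S) c with hA'
    have h1 : ∀ c ∈ A, (1 - I.card * ε) * N ≤
        (Finset.univ.filter fun k => resample node v c k ∈ A').card := by
      intro c hc
      replace hc : IsExtendable node I Good S c := (Finset.mem_filter.1 hc).2
      unfold IsExtendable at hc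
      -- Each event has its own completion of the blocks in `S`; the same fresh block `v` is put
      -- into all of them, and a union bound over the events applies.
      choose! c' hc' hgood using hc
      have h2 : (Finset.univ.filter fun k => ¬ resample node v c k ∈ A') ⊆
          I.biUnion fun i => Finset.univ.filter fun k => ¬ Good i (resample node v (c' i) k) := by
        intro k hk
        by_contra hcon
        simp only [Finset.mem_biUnion, Finset.mem_filter, Finset.mem_univ, true_and, not_exists,
          not_and, not_not] at hcon
        refine (Finset.mem_filter.1 hk).2 (Finset.mem_filter.2 ⟨Finset.mem_univ _, fun i hi =>
          ⟨_, fun p hp => ?_, hcon i hi⟩⟩)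
        unfold resample
        split_ifs with hpv
        · rfl
        · exact hc' i hi p ((Finset.mem_insert.1 hp).resolve_left hpv)
      have h3 : ((Finset.univ.filter fun k => ¬ resample node v c k ∈ A').card : ℝ) ≤
          I.card * ε * N := by
        refine (Nat.cast_le.2 ((Finset.card_le_card h2).trans Finset.card_biUnion_le)).trans ?_
        push_cast
        refine (Finset.sum_le_card_nsmul _ _ (ε * N) fun i hi =>
          hstep i hi _ (hgood i hi) v).trans (le_of_eq ?_)
        rw [nsmul_eq_mul, mul_assoc]
      have h4 : ((Finset.univ.filter fun k => resample node v c k ∈ A').card : ℝ) +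
          (Finset.univ.filter fun k => ¬ resample node v c k ∈ A').card = N := by
        rw [hN, ← Finset.card_univ, ← Finset.card_filter_add_card_filter_not
          (s := (Finset.univ : Finset (P → β))) (fun k => resample node v c k ∈ A')]
        push_cast
        rfl
      linarith
    have h5 : ∑ c ∈ A, (Finset.univ.filter fun k => resample node v c k ∈ A').card ≤
        A'.card * Fintype.card (P → β) := by
      rw [← Finset.card_sigma, ← Finset.card_univ, ← Finset.card_product]
      -- Exchanging the block `v` between two configurations is injective on pairs, so a resampled
      -- uniform configuration is again uniform.
      refine Finset.card_le_card_of_injOn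
        (fun x => (resample node v x.1 x.2, resample node v x.2 x.1)) ?_ ?_
      · rintro ⟨c, k⟩ hx
        have := (Finset.mem_sigma.1 (Finset.mem_coe.1 hx)).2
        simp only [Finset.coe_product, Set.mem_prod, Finset.mem_coe, Finset.mem_univ, and_true]
        exact (Finset.mem_filter.1 this).2
      · rintro ⟨c, k⟩ - ⟨c₁, k₁⟩ - heq
        simp only [Prod.mk.injEq] at heq
        have hck : c = c₁ ∧ k = k₁ := by
          constructor <;>
          · funext p
            have e1 := congrFun heq.1 p
            have e2 := congrFun heq.2 p
            simp only [resample] at e1 e2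
            split_ifs at e1 e2 <;> assumption
        rw [hck.1, hck.2]
    have h6 : (A.card : ℝ) * ((1 - I.card * ε) * N) ≤ A'.card * N := by
      rw [← nsmul_eq_mul]
      refine (Finset.card_nsmul_le_sum _ _ _ h1).trans ?_
      rw [hN]
      exact_mod_cast h5
    have h7 : (A.card : ℝ) * (1 - I.card * ε) ≤ A'.card := by
      rw [← mul_assoc] at h6
      exact le_of_mul_le_mul_right h6 hNpos
    rw [Finset.card_insert_of_notMem hv, pow_succ]
    calc (1 - I.card * ε) ^ S.card * (1 - I.card * ε) * N
        = ((1 - I.card * ε) ^ S.card * N) * (1 - I.card * ε) := by ring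
      _ ≤ A.card * (1 - I.card * ε) := mul_le_mul_of_nonneg_right ih (by linarith)
      _ ≤ A'.card := h7

end Counting

/-! ### Resampling the coefficients at one node -/

namespace Network

variable {V E : Type*} [Fintype V] [DecidableEq V] [Fintype E] [DecidableEq E]
variable {F : Type*} [Field F] {w : ℕ}

theorem coef_resample (G : Network V E) (v : V) (c k : G.Code F w) (a : Fin w ⊕ E) (e : E) :
    G.coef (resample G.pairNode v c k) a e = if G.tail e = v then G.coef k a e else G.coef c a e := by
  rcases a with i | d
  · by_cases h : G.tail e = G.source
    · by_cases hv : G.source = v <;> simp [coef, resample, pairNode, h, hv]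
    · simp [coef, h]
  · by_cases h : G.head d = G.tail e
    · by_cases hv : G.tail e = v <;> simp [coef, resample, pairNode, h, hv]
    · simp [coef, h]

theorem coef_add (G : Network V E) (c k : G.Code F w) (a : Fin w ⊕ E) (e : E) :
    G.coef (c + k) a e = G.coef c a e + G.coef k a e := by
  rcases a with i | d <;> simp only [coef] <;> split_ifs <;> simp

theorem coef_sub (G : Network V E) (c k : G.Code F w) (a : Fin w ⊕ E) (e : E) :
    G.coef (c - k) a e = G.coef c a e - G.coef k a e := by
  rcases a with i | d <;> simp only [coef] <;> split_ifs <;> simp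

theorem coef_smul (G : Network V E) (r : F) (k : G.Code F w) (a : Fin w ⊕ E) (e : E) :
    G.coef (r • k) a e = r * G.coef k a e := by
  rcases a with i | d <;> simp only [coef] <;> split_ifs <;> simp

/-- The matrix of the local encoding coefficients at the node `v`. -/
def nodeMatrix (G : Network V E) (v : V) :
    G.Code F w →ₗ[F] Matrix (Fin w ⊕ E) (Fin w ⊕ E) F where
  toFun k := Matrix.of fun a => Sum.elim 0 fun e => if G.tail e = v then G.coef k a e else 0
  map_add' k k' := by
    ext a b
    rcases b with i | e
    · simp
    · simp only [Matrix.of_apply, Sum.elim_inr, Matrix.add_apply, coef_add]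
      split_ifs <;> simp
  map_smul' r k := by
    ext a b
    rcases b with i | e
    · simp
    · simp only [Matrix.of_apply, Sum.elim_inr, Matrix.smul_apply, coef_smul]
      split_ifs <;> simp

theorem nodeMatrix_inl (G : Network V E) (v : V) (k : G.Code F w) (a : Fin w ⊕ E) (i : Fin w) :
    G.nodeMatrix v k a (Sum.inl i) = 0 := rfl

theorem nodeMatrix_inr (G : Network V E) (v : V) (k : G.Code F w) (a : Fin w ⊕ E) (e : E) :
    G.nodeMatrix v k a (Sum.inr e) = if G.tail e = v then G.coef k a e else 0 := rfl

theorem nodeMatrix_ne_zero (G : Network V E) {v : V} {k : G.Code F w} {a b : Fin w ⊕ E}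
    (h : G.nodeMatrix v k a b ≠ 0) :
    G.chanHead a = v ∧ ∃ e, b = Sum.inr e ∧ G.tail e = v := by
  rcases b with i | e
  · exact absurd rfl h
  rw [nodeMatrix_inr] at h
  split_ifs at h with hv
  · refine ⟨?_, e, rfl, hv⟩
    by_contra hne
    exact h (G.coef_of_ne k (hv ▸ hne))
  · exact absurd rfl h

theorem localMatrix_resample_sub (G : Network V E) (v : V) (c k : G.Code F w) :
    G.localMatrix (resample G.pairNode v c k) - G.localMatrix c = G.nodeMatrix v (k - c) := by
  ext a b
  rcases b with i | e
  · simp [localMatrix, nodeMatrix_inl]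
  · simp only [localMatrix, Matrix.sub_apply, Matrix.of_apply, Sum.elim_inr, coef_resample,
      nodeMatrix_inr, coef_sub]
    split_ifs <;> simp

/-- A nonzero entry would yield a channel out of `v` from which a channel into `v` is reached, that
is, a cycle. Hence the kernels are affine in the coefficients at a single node. -/
theorem nodeMatrix_mul_kernelMatrix_mul_nodeMatrix (G : Network V E) (v : V)
    (c k k' : G.Code F w) :
    G.nodeMatrix v k * G.kernelMatrix c * G.nodeMatrix v k' = 0 := by
  ext a b
  rw [Matrix.mul_apply, Matrix.zero_apply]
  refine Finset.sum_eq_zero fun f _ => ?_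
  by_contra hne
  have h1 := left_ne_zero_of_mul hne
  have h2 := right_ne_zero_of_mul hne
  rw [Matrix.mul_apply] at h1
  obtain ⟨d, -, hd⟩ := Finset.exists_ne_zero_of_sum_ne_zero h1
  obtain ⟨-, e, rfl, he⟩ := G.nodeMatrix_ne_zero (left_ne_zero_of_mul hd)
  have hreach := G.reflTransGen_of_kernelMatrix_ne_zero c (right_ne_zero_of_mul hd)
  exact G.not_transGen_chanAdj _ (Relation.TransGen.tail' hreach
    ⟨e, rfl, (G.nodeMatrix_ne_zero h2).1.trans he.symm⟩)

/-- The effect of resampling the coefficients at one node on the global encoding kernels. -/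
theorem kernelMatrix_resample (G : Network V E) (v : V) (c k : G.Code F w) :
    G.kernelMatrix (resample G.pairNode v c k) =
      G.kernelMatrix c + G.kernelMatrix c * G.nodeMatrix v (k - c) * G.kernelMatrix c := by
  have h := G.kernelMatrix_sub c (resample G.pairNode v c k)
  rw [localMatrix_resample_sub, sub_eq_iff_eq_add] at h
  have h1 := congrArg (· * G.nodeMatrix v (k - c)) h
  simp only [add_mul] at h1
  rw [mul_assoc, mul_assoc, ← mul_assoc (G.nodeMatrix v (k - c)),
    nodeMatrix_mul_kernelMatrix_mul_nodeMatrix, mul_zero, zero_add] at h1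
  rw [h, h1, add_comm]

/-- The linear map giving the received vector at `t` in terms of messages and errors. -/
noncomputable def receive (G : Network V E) (c : G.Code F w) (t : V) :
    (Fin w ⊕ E → F) →ₗ[F] (G.In t → F) :=
  (LinearMap.funLeft F F fun e : G.In t => (Sum.inr e.1 : Fin w ⊕ E)) ∘ₗ
    (G.kernelMatrix c).vecMulLinear

theorem receive_apply (G : Network V E) (c : G.Code F w) (t : V) (x : Fin w ⊕ E → F) :
    G.receive c t x = ∑ a, x a • G.decodingRow c t a := by
  ext e
  simp [receive, LinearMap.funLeft_apply, Matrix.vecMul, dotProduct, decodingRow_apply]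

theorem receive_resample (G : Network V E) (v : V) (c k : G.Code F w) (t : V)
    (x : Fin w ⊕ E → F) :
    G.receive (resample G.pairNode v c k) t x = G.receive c t x +
      G.receive c t (Matrix.vecMul (Matrix.vecMul x (G.kernelMatrix c))
        (G.nodeMatrix v (k - c))) := by
  ext e
  simp [receive, LinearMap.funLeft_apply, kernelMatrix_resample, Matrix.vecMul_vecMul, mul_assoc]

theorem linearIndepOn_decodingRow_iff (G : Network V E) (c : G.Code F w) (t : V)
    (R : Finset (Fin w ⊕ E)) :
    LinearIndepOn F (G.decodingRow c t) (R : Set (Fin w ⊕ E)) ↔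
      ∀ x : Fin w ⊕ E → F, (∀ a, a ∉ R → x a = 0) → G.receive c t x = 0 → x = 0 := by
  rw [linearIndepOn_finset_iff]
  constructor
  · intro h x hx hx0
    rw [receive_apply, ← Finset.sum_subset (Finset.subset_univ R)
      fun a _ ha => by rw [hx a ha, zero_smul]] at hx0
    funext a
    by_cases ha : a ∈ R
    · exact h x hx0 a ha
    · exact hx a ha
  · intro h x hx a ha
    have h1 := h (fun a => if a ∈ R then x a else 0) (fun a ha => if_neg ha) (by
      rw [receive_apply, ← hx]
      simp [ite_smul, Finset.sum_ite_mem])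
    simpa [ha] using congrFun h1 a

open Classical in
/-- Resampling the coefficients at one node preserves the linear independence of a set of rows of
the decoding matrix with probability at least `1 - 1 / (|F| - 1)`. -/
theorem card_not_linearIndepOn_resample_mul_le [Fintype F] (G : Network V E) (c : G.Code F w)
    (t : V) (R : Finset (Fin w ⊕ E))
    (h : LinearIndepOn F (G.decodingRow c t) (R : Set (Fin w ⊕ E))) (v : V) :
    (Finset.univ.filter fun k : G.Code F w => ¬ LinearIndepOn F
      (G.decodingRow (resample G.pairNode v c k) t) (R : Set (Fin w ⊕ E))).card *
        (Fintype.card F - 1) ≤ Fintype.card (G.Code F w) := by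
  let X : Submodule F (Fin w ⊕ E → F) :=
    { carrier := {x | ∀ a, a ∉ R → x a = 0}
      add_mem' := fun hx hy a ha => by simp [hx a ha, hy a ha]
      zero_mem' := fun a _ => rfl
      smul_mem' := fun r x hx a ha => by simp [hx a ha] }
  obtain ⟨L, hL⟩ := ((G.receive c t).comp X.subtype).exists_leftInverse_of_injective (by
    rw [LinearMap.ker_eq_bot']
    rintro ⟨x, hx⟩ hx0
    exact Subtype.ext ((G.linearIndepOn_decodingRow_iff c t R).1 h x hx hx0))
  let π : (Fin w ⊕ E → F) →ₗ[F] (Fin w ⊕ E → F) :=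
    LinearMap.pi fun a => if G.chanHead a = v then LinearMap.proj a else 0
  have hπ : ∀ z a, π z a = if G.chanHead a = v then z a else 0 := by
    intro z a
    simp only [π, LinearMap.pi_apply]
    split_ifs <;> simp
  -- If `x` supported on `R` is annihilated after resampling, let y be the part of xK on the
  -- channels entering `v`, where K is the kernel matrix. Applying `L` recovers `x` from y, and
  -- restricting xK again gives y = -H(yN), with N the node matrix of k - c. So failure of
  -- independence is a nonzero fixed vector of `B · (k - c)`.
  let H : (Fin w ⊕ E → F) →ₗ[F] (Fin w ⊕ E → F) :=
    π ∘ₗ (G.kernelMatrix c).vecMulLinear ∘ₗ X.subtype ∘ₗ L ∘ₗ G.receive c t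
  let B : (Fin w ⊕ E → F) →ₗ[F] G.Code F w →ₗ[F] (Fin w ⊕ E → F) :=
    LinearMap.mk₂ F (fun y k => -H (Matrix.vecMul y (G.nodeMatrix v k)))
      (fun y y' k => by rw [Matrix.add_vecMul, map_add, neg_add])
      (fun r y k => by rw [Matrix.smul_vecMul, map_smul, smul_neg])
      (fun y k k' => by rw [map_add, Matrix.vecMul_add, map_add, neg_add])
      (fun r y k => by rw [map_smul, Matrix.vecMul_smul, map_smul, smul_neg])
  have hBdef : ∀ y k, B y k = -H (Matrix.vecMul y (G.nodeMatrix v k)) := fun _ _ => rfl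
  let Z : Submodule F (Fin w ⊕ E → F) :=
    { carrier := {z | ∀ b, (∀ e, b = Sum.inr e → G.tail e ≠ v) → z b = 0}
      add_mem' := fun hx hy a ha => by simp [hx a ha, hy a ha]
      zero_mem' := fun a _ => rfl
      smul_mem' := fun r x hx a ha => by simp [hx a ha] }
  have hZ : ∀ y k, Matrix.vecMul y (G.nodeMatrix v k) ∈ Z := by
    intro y k b hb
    rw [Matrix.vecMul, dotProduct]
    refine Finset.sum_eq_zero fun a _ => ?_
    by_contra hne
    obtain ⟨-, e, he, hev⟩ := G.nodeMatrix_ne_zero (right_ne_zero_of_mul hne)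
    exact hb e he hev
  rw [← Finset.card_image_of_injective _ (sub_left_injective (b := c))]
  refine card_exists_fixed_mul_le B (Z.map H) ?_ ?_ _ ?_
  rotate_left 2
  · intro k' hk'
    obtain ⟨k, hk, rfl⟩ := Finset.mem_image.1 hk'
    replace hk := (Finset.mem_filter.1 hk).2
    rw [linearIndepOn_decodingRow_iff] at hk
    push Not at hk
    obtain ⟨x, hxR, hx0, hxne⟩ := hk
    rw [receive_resample] at hx0
    refine ⟨π (Matrix.vecMul x (G.kernelMatrix c)), ?_⟩
    have hN : Matrix.vecMul (π (Matrix.vecMul x (G.kernelMatrix c))) (G.nodeMatrix v (k - c)) =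
        Matrix.vecMul (Matrix.vecMul x (G.kernelMatrix c)) (G.nodeMatrix v (k - c)) := by
      ext b
      simp only [Matrix.vecMul, dotProduct]
      refine Finset.sum_congr rfl fun a _ => ?_
      by_cases hab : G.nodeMatrix v (k - c) a b = 0
      · rw [hab, mul_zero, mul_zero]
      · rw [hπ, if_pos (G.nodeMatrix_ne_zero hab).1]
        rfl
    rw [← hN] at hx0
    set y := π (Matrix.vecMul x (G.kernelMatrix c)) with hy
    have hLx : (L (G.receive c t x) : Fin w ⊕ E → F) = x :=
      congrArg Subtype.val (LinearMap.congr_fun hL ⟨x, hxR⟩)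
    have hx : x = -(L (G.receive c t (Matrix.vecMul y (G.nodeMatrix v (k - c)))) :
        Fin w ⊕ E → F) := by
      have h1 := congrArg (fun z => (L z : Fin w ⊕ E → F)) hx0
      simp only [map_add, Submodule.coe_add, map_zero, Submodule.coe_zero] at h1
      rw [hLx] at h1
      exact eq_neg_of_add_eq_zero_left h1
    constructor
    · intro hy0
      rw [hy0] at hx
      exact hxne (by simpa using hx)
    · rw [hBdef]
      conv_rhs => rw [hy, hx]
      rw [Matrix.neg_vecMul, map_neg]
      rfl
  · intro y k
    rw [hBdef]
    exact Submodule.neg_mem _ (Submodule.mem_map_of_mem (hZ y k))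
  · rintro y ⟨z₁, -, rfl⟩ hy _ ⟨z₀, hz₀, rfl⟩
    obtain ⟨a₀, ha₀⟩ := Function.ne_iff.1 hy
    have hav : G.chanHead a₀ = v := by
      by_contra hne
      refine ha₀ ?_
      simp only [H, LinearMap.comp_apply]
      rw [hπ, if_neg hne]
      rfl
    set y := H z₁
    rw [Pi.zero_apply] at ha₀
    -- One incoming channel `a₀` of `v` with `y a₀ ≠ 0` suffices to produce any prescribed vector on
    -- the outgoing channels.
    refine ⟨G.toCode fun a e => if a = a₀ then -(z₀ (Sum.inr e) / y a₀) else 0, ?_⟩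
    rw [hBdef, ← map_neg]
    congr 1
    ext b
    rcases b with i | e
    · rw [hz₀ (Sum.inl i) (by simp)]
      simp [Matrix.vecMul, dotProduct, nodeMatrix_inl]
    · simp only [Pi.neg_apply, Matrix.vecMul, dotProduct, nodeMatrix_inr, coef_toCode]
      by_cases hev : G.tail e = v
      · rw [Finset.sum_eq_single a₀]
        · simp only [hev, hav, if_true]
          field_simp
        · intro a _ ha
          simp [ha]
        · simp
      · rw [hz₀ (Sum.inr e) (by rintro f hf; cases hf; exact hev)]
        simp [hev]

/-! ### Generic codes and their probability -/

/-- At every sink node `t`, the message rows together with the rows of any linked error pattern of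
cardinality `C_t - w` are linearly independent. -/
def IsGeneric (G : Network V E) (c : G.Code F w) : Prop :=
  ∀ t ∈ G.sinks, ∀ σ : Finset E, σ.card = G.minCut t - w →
    Linked G.ChanAdj (G.IsInChan t) ((Finset.univ : Finset (Fin w)).disjSum σ) →
    LinearIndepOn F (G.decodingRow c t)
      ((Finset.univ : Finset (Fin w)).disjSum σ : Finset (Fin w ⊕ E))

theorem coe_univ_disjSum (σ : Finset E) :
    (((Finset.univ : Finset (Fin w)).disjSum σ : Finset (Fin w ⊕ E)) : Set (Fin w ⊕ E)) =
      Set.range Sum.inl ∪ Sum.inr '' (σ : Set E) := by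
  ext a
  rcases a with i | e <;> simp

theorem IsGeneric.disjoint {G : Network V E} {c : G.Code F w} (h : G.IsGeneric c)
    {t : V} (ht : t ∈ G.sinks) (hcut : w ≤ G.minCut t) {ρ : Finset E}
    (hρ : ρ.card ≤ G.minCut t - w) : Disjoint (G.errorSpace c t ρ) (G.messageSpace c t) := by
  obtain ⟨σ, hσ, hle, hL⟩ := G.exists_linked_card_eq (F := F) (w := w) ht
    (δ := G.minCut t - w) (by omega) ρ hρ
  have h1 := h t ht σ hσ hL
  rw [coe_univ_disjSum, linearIndepOn_union_iff (Set.disjoint_left.2 (by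
    rintro _ ⟨i, rfl⟩ ⟨e, -, he⟩; cases he))] at h1
  have h2 := h1.2.2
  rw [← messageSpace_eq_span, ← errorSpace_eq_span] at h2
  exact h2.symm.mono_left (hle c)

theorem IsGeneric.vecMul_eq_zero {G : Network V E} {c : G.Code F w} (h : G.IsGeneric c)
    {t : V} (ht : t ∈ G.sinks) (hcut : w ≤ G.minCut t) {X : Fin w → F}
    (hX : Matrix.vecMul X (G.messageMatrix c t) = 0) : X = 0 := by
  obtain ⟨σ, hσ, -, hL⟩ := G.exists_linked_card_eq (F := F) (w := w) ht
    (δ := G.minCut t - w) (by omega) ∅ (by simp)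
  have h1 := (G.linearIndepOn_decodingRow_iff c t _).1 (h t ht σ hσ hL) (Sum.elim X 0)
    (fun a ha => by rcases a with i | e; · simp at ha
                    · rfl)
    (by rw [receive_apply, Fintype.sum_sum_type]
        simpa [vecMul_messageMatrix] using hX)
  funext i
  exact congrFun h1 (Sum.inl i)

theorem IsGeneric.isMDS {G : Network V E} {c : G.Code F w} (h : G.IsGeneric c) (hw : 1 ≤ w)
    (hcut : ∀ t ∈ G.sinks, w ≤ G.minCut t) : G.IsMDS c :=
  G.isMDS_of_disjoint c hw hcut
    (fun t ht => G.finrank_messageSpace c t fun _ hX => h.vecMul_eq_zero ht (hcut t ht) hX)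
    fun t ht _ hρ => h.disjoint ht (hcut t ht) hρ

open Classical in
theorem pow_mul_card_le_card_isGeneric [Fintype F] (G : Network V E)
    (hF : ∑ t ∈ G.sinks, (Fintype.card E).choose (G.minCut t - w) < Fintype.card F) :
    (1 - (∑ t ∈ G.sinks, ((Fintype.card E).choose (G.minCut t - w) : ℝ)) /
        ((Fintype.card F : ℝ) - 1)) ^ (G.internalNodes.card + 1) * Fintype.card (G.Code F w) ≤
      (Finset.univ.filter fun c : G.Code F w => G.IsGeneric c).card := by
  let I : Finset (Σ _ : V, Finset E) := G.sinks.sigma fun t =>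
    (Finset.univ.powersetCard (G.minCut t - w)).filter fun σ =>
      Linked G.ChanAdj (G.IsInChan t) ((Finset.univ : Finset (Fin w)).disjSum σ)
  let Good : (Σ _ : V, Finset E) → G.Code F w → Prop := fun i c =>
    LinearIndepOn F (G.decodingRow c i.1)
      ((Finset.univ : Finset (Fin w)).disjSum i.2 : Finset (Fin w ⊕ E))
  have hImem : ∀ i, i ∈ I ↔ i.1 ∈ G.sinks ∧ i.2.card = G.minCut i.1 - w ∧
      Linked G.ChanAdj (G.IsInChan i.1) ((Finset.univ : Finset (Fin w)).disjSum i.2) := by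
    intro i
    simp [I, Finset.mem_powersetCard]
  have hq1 : 1 < Fintype.card F := Fintype.one_lt_card
  have hq : (0 : ℝ) < (Fintype.card F : ℝ) - 1 := by
    have : (1 : ℝ) < Fintype.card F := by exact_mod_cast hq1
    linarith
  have hI : I.card ≤ ∑ t ∈ G.sinks, (Fintype.card E).choose (G.minCut t - w) := by
    rw [Finset.card_sigma]
    refine Finset.sum_le_sum fun t _ => (Finset.card_filter_le _ _).trans ?_
    rw [Finset.card_powersetCard, Finset.card_univ]
  have hIle : (I.card : ℝ) * (1 / ((Fintype.card F : ℝ) - 1)) ≤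
      (∑ t ∈ G.sinks, ((Fintype.card E).choose (G.minCut t - w) : ℝ)) /
        ((Fintype.card F : ℝ) - 1) := by
    rw [mul_one_div]
    gcongr
    exact_mod_cast hI
  have hle1 : (∑ t ∈ G.sinks, ((Fintype.card E).choose (G.minCut t - w) : ℝ)) /
      ((Fintype.card F : ℝ) - 1) ≤ 1 := by
    rw [div_le_one hq, le_sub_iff_add_le]
    exact_mod_cast hF
  have hmain := pow_mul_card_le_card_forall G.pairNode I Good (1 / ((Fintype.card F : ℝ) - 1))
    (fun i hi => by
      obtain ⟨h1, -, h3⟩ := (hImem i).1 hi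
      exact G.exists_linearIndepOn_of_linked h1 h3)
    (fun i _ c hc v => by
      have h1 := G.card_not_linearIndepOn_resample_mul_le c i.1 _ hc v
      rw [one_div, ← div_eq_inv_mul, le_div_iff₀ hq]
      have h2 : ((Fintype.card F - 1 : ℕ) : ℝ) = (Fintype.card F : ℝ) - 1 := by
        rw [Nat.cast_sub hq1.le, Nat.cast_one]
      rw [← h2]
      exact_mod_cast h1)
    (hIle.trans hle1) (insert G.source G.internalNodes)
  have hcard : (insert G.source G.internalNodes).card = G.internalNodes.card + 1 :=
    Finset.card_insert_of_notMem (by simp [internalNodes])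
  rw [hcard] at hmain
  refine le_trans ?_ (hmain.trans (Nat.cast_le.2 (Finset.card_le_card fun c hc => ?_)))
  · gcongr
  · have hc : IsExtendable G.pairNode I Good (insert G.source G.internalNodes) c :=
      (Finset.mem_filter.1 hc).2
    refine Finset.mem_filter.2 ⟨Finset.mem_univ _, fun t ht σ hσ hL => ?_⟩
    obtain ⟨c', hc', hgood⟩ := hc ⟨t, σ⟩ ((hImem _).2 ⟨ht, hσ, hL⟩)
    -- Sinks have no outgoing channels, so every adjacent pair meets at the source or an internal
    -- node, and these blocks determine the whole code.
    have hcc : c' = c := by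
      funext p
      refine hc' p ?_
      rcases p with p | p
      · simp [pairNode]
      · have := G.tail_notMem_sinks p.1.2
        simp only [pairNode, internalNodes, Finset.mem_insert, Finset.mem_sdiff, Finset.mem_univ,
          true_and]
        tauto
    rw [hcc] at hgood
    exact hgood

/-! ### Reduction from rate m + 1 to rate m -/

theorem errorSpace_reduce (G : Network V E) {m : ℕ} (c : G.Code F (m + 1)) (k : Fin m → F)
    (t : V) (ρ : Finset E) : G.errorSpace (G.reduce c k) t ρ = G.errorSpace c t ρ := by
  have h : G.errorMatrix (G.reduce c k) t = G.errorMatrix c t := by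
    ext a e
    exact (G.extKernel_reduce c k e.1).2 a
  rw [errorSpace, errorSpace, h]

theorem vecMul_messageMatrix_reduce (G : Network V E) {m : ℕ} (c : G.Code F (m + 1))
    (k : Fin m → F) (t : V) (X : Fin m → F) :
    Matrix.vecMul X (G.messageMatrix (G.reduce c k) t) =
      Matrix.vecMul (Fin.snoc X (∑ i, X i * k i) : Fin (m + 1) → F) (G.messageMatrix c t) := by
  ext e
  have h : ∀ i, G.messageMatrix (G.reduce c k) t i e =
      G.messageMatrix c t i.castSucc e + k i * G.messageMatrix c t (Fin.last m) e :=
    (G.extKernel_reduce c k e.1).1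
  simp only [Matrix.vecMul, dotProduct, Fin.sum_univ_castSucc, Fin.snoc_castSucc, Fin.snoc_last,
    h, Finset.sum_mul, ← Finset.sum_add_distrib]
  exact Finset.sum_congr rfl fun i _ => by ring

/-- If the error patterns of cardinality `n` have error spaces disjoint from the message space, then
the messages whose images lie in a given error space of a pattern of cardinality `n + 1` are all
proportional. -/
theorem exists_smul_eq_of_mem_errorSpace (G : Network V E) (c : G.Code F w) (t : V) {n : ℕ}
    (hinj : ∀ X, Matrix.vecMul X (G.messageMatrix c t) = 0 → X = 0)
    (hdisj : ∀ ρ : Finset E, ρ.card ≤ n → Disjoint (G.errorSpace c t ρ) (G.messageSpace c t))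
    {ρ : Finset E} (hρ : ρ.card = n + 1) {X Y : Fin w → F} (hX0 : X ≠ 0)
    (hX : Matrix.vecMul X (G.messageMatrix c t) ∈ G.errorSpace c t ρ)
    (hY : Matrix.vecMul Y (G.messageMatrix c t) ∈ G.errorSpace c t ρ) :
    ∃ r : F, Y = r • X := by
  obtain ⟨e, he⟩ := Finset.card_pos.1 (show 0 < ρ.card by omega)
  have hzero : ∀ (W : Fin w → F) (Z : E → F), (∀ f, f ∉ ρ → Z f = 0) → Z e = 0 →
      Matrix.vecMul Z (G.errorMatrix c t) = Matrix.vecMul W (G.messageMatrix c t) → W = 0 := by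
    intro W Z hZ hZe hZW
    refine hinj W ((Submodule.disjoint_def.1 (hdisj (ρ.erase e) ?_)) _ ?_ ⟨W, rfl⟩)
    · rw [Finset.card_erase_of_mem he]
      omega
    · refine (G.mem_errorSpace c t _ _).2 ⟨Z, fun f hf => ?_, hZW⟩
      by_cases hfe : f = e
      · rw [hfe, hZe]
      · exact hZ f fun h => hf (Finset.mem_erase.2 ⟨hfe, h⟩)
  obtain ⟨Z, hZ, hZX⟩ := (G.mem_errorSpace c t _ _).1 hX
  obtain ⟨Z', hZ', hZY⟩ := (G.mem_errorSpace c t _ _).1 hY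
  have hZe : Z e ≠ 0 := fun h => hX0 (hzero X Z hZ h hZX)
  -- The multiple is chosen to cancel the error on `e`; what remains matches only `n` channels, so
  -- its message vanishes.
  refine ⟨Z' e / Z e, sub_eq_zero.1 (hzero _ (Z' - (Z' e / Z e) • Z) (fun f hf => ?_) ?_ ?_)⟩
  · simp [hZ f hf, hZ' f hf]
  · simp [hZe]
  · rw [Matrix.sub_vecMul, Matrix.sub_vecMul, Matrix.smul_vecMul, Matrix.smul_vecMul, hZX, hZY]

open Classical in
-- A bad `k` provides a nonzero X for which the lifted message (X, X·k) has its image in the error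
-- space of `ρ`. All such lifts are proportional to a single (X₀, X₀·k₀), which forces X₀·k = X₀·k₀,
-- an affine hyperplane.
theorem card_not_disjoint_reduce_mul_le [Fintype F] (G : Network V E) {m : ℕ}
    (c : G.Code F (m + 1)) (t : V) {n : ℕ}
    (hinj : ∀ X, Matrix.vecMul X (G.messageMatrix c t) = 0 → X = 0)
    (hdisj : ∀ ρ : Finset E, ρ.card ≤ n → Disjoint (G.errorSpace c t ρ) (G.messageSpace c t))
    {ρ : Finset E} (hρ : ρ.card = n + 1) :
    (Finset.univ.filter fun k : Fin m → F => ¬ Disjoint (G.errorSpace (G.reduce c k) t ρ)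
      (G.messageSpace (G.reduce c k) t)).card * Fintype.card F ≤ Fintype.card (Fin m → F) := by
  set bad := Finset.univ.filter fun k : Fin m → F => ¬ Disjoint (G.errorSpace (G.reduce c k) t ρ)
      (G.messageSpace (G.reduce c k) t) with hbad
  have hex : ∀ k ∈ bad, ∃ X : Fin m → F, X ≠ 0 ∧
      Matrix.vecMul (Fin.snoc X (∑ i, X i * k i) : Fin (m + 1) → F) (G.messageMatrix c t) ∈
        G.errorSpace c t ρ := by
    intro k hk
    replace hk := (Finset.mem_filter.1 hk).2
    rw [Submodule.disjoint_def] at hk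
    push Not at hk
    obtain ⟨y, hy, ⟨X, rfl⟩, hne⟩ := hk
    rw [errorSpace_reduce] at hy
    rw [Matrix.vecMulLinear_apply, vecMul_messageMatrix_reduce] at hy hne
    refine ⟨X, ?_, hy⟩
    rintro rfl
    refine hne ?_
    have h0 : (Fin.snoc (0 : Fin m → F) (∑ i, (0 : Fin m → F) i * k i) : Fin (m + 1) → F) = 0 := by
      funext i
      refine Fin.lastCases ?_ (fun j => ?_) i <;> simp
    rw [h0, Matrix.zero_vecMul]
  rcases bad.eq_empty_or_nonempty with hemp | ⟨k₀, hk₀⟩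
  · simp [hemp]
  obtain ⟨X₀, hX₀, hX₀ρ⟩ := hex k₀ hk₀
  obtain ⟨j, hj⟩ := Function.ne_iff.1 hX₀
  let f : (Fin m → F) →+ F := (∑ i, X₀ i • LinearMap.proj (R := F) (φ := fun _ : Fin m => F) i :
    (Fin m → F) →ₗ[F] F).toAddMonoidHom
  have hf : ∀ k, f k = ∑ i, X₀ i * k i := by
    intro k
    simp [f]
  have hsub : bad ⊆ Finset.univ.filter fun k => f k = f k₀ := by
    intro k hk
    obtain ⟨X, hX, hXρ⟩ := hex k hk
    obtain ⟨r, hr⟩ := G.exists_smul_eq_of_mem_errorSpace c t hinj hdisj hρ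
      (X := Fin.snoc X₀ (∑ i, X₀ i * k₀ i)) (fun h => hj (by
        simpa using congrFun h j.castSucc)) hX₀ρ hXρ
    have h1 : X = r • X₀ := by
      funext i
      simpa using congrFun hr i.castSucc
    have h2 : ∑ i, X i * k i = r * ∑ i, X₀ i * k₀ i := by
      simpa using congrFun hr (Fin.last m)
    have hr0 : r ≠ 0 := by
      rintro rfl
      exact hX (by rw [h1, zero_smul])
    refine Finset.mem_filter.2 ⟨Finset.mem_univ _, ?_⟩
    rw [hf, hf]
    apply mul_left_cancel₀ hr0
    rw [← h2, h1, Finset.mul_sum]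
    exact Finset.sum_congr rfl fun i _ => by simp [mul_assoc]
  refine (Nat.mul_le_mul_right _ (Finset.card_le_card hsub)).trans ?_
  rw [← Finset.card_univ (α := F)]
  refine card_fiber_mul_card_le f _ Finset.univ fun z _ => ⟨Pi.single j (z / X₀ j), ?_⟩
  rw [hf]
  simp only [Pi.zero_apply] at hj
  simp [Pi.single_apply]
  field_simp

theorem IsGeneric.isMDS_reduce {G : Network V E} {m : ℕ} {c : G.Code F (m + 1)}
    (h : G.IsGeneric c) (hm : 1 ≤ m) (hcut : ∀ t ∈ G.sinks, m + 1 ≤ G.minCut t) (k : Fin m → F)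
    (hk : ∀ t ∈ G.sinks, ∀ ρ : Finset E, ρ.card = G.minCut t - (m + 1) + 1 →
      Disjoint (G.errorSpace (G.reduce c k) t ρ) (G.messageSpace (G.reduce c k) t)) :
    G.IsMDS (G.reduce c k) := by
  refine G.isMDS_of_disjoint _ hm (fun t ht => (Nat.le_succ m).trans (hcut t ht)) (fun t ht => ?_)
    fun t ht ρ hρ => ?_
  · refine G.finrank_messageSpace _ t fun X hX => ?_
    rw [vecMul_messageMatrix_reduce] at hX
    have h1 := h.vecMul_eq_zero ht (hcut t ht) hX
    funext i
    simpa using congrFun h1 i.castSucc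
  · have h1 := hcut t ht
    have h2 := G.minCut_le_card ht
    -- Enlarging `ρ` to exactly C_t - m channels is possible because C_t ≤ |E|.
    obtain ⟨σ, hρσ, hσ⟩ := Finset.exists_superset_card_eq
      (show ρ.card ≤ G.minCut t - (m + 1) + 1 by omega) (by omega)
    exact (hk t ht σ hσ).mono_left (G.errorSpace_mono _ t hρσ)

open Classical in
/-- For a generic code, most of the reduced codes are network MDS codes. -/
theorem IsGeneric.le_card_isMDS_reduce [Fintype F] {G : Network V E} {m : ℕ}
    {c : G.Code F (m + 1)} (h : G.IsGeneric c) (hm : 1 ≤ m)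
    (hcut : ∀ t ∈ G.sinks, m + 1 ≤ G.minCut t) :
    (1 - (∑ t ∈ G.sinks, ((Fintype.card E).choose (G.minCut t - (m + 1) + 1) : ℝ)) /
        (Fintype.card F : ℝ)) * Fintype.card (Fin m → F) ≤
      (Finset.univ.filter fun k : Fin m → F => G.IsMDS (G.reduce c k)).card := by
  set q : ℝ := (Fintype.card F : ℝ) with hq
  have hqpos : 0 < q := by
    rw [hq]
    exact_mod_cast Fintype.card_pos
  let bad : V → Finset E → Finset (Fin m → F) := fun t ρ => Finset.univ.filter fun k =>
    ¬ Disjoint (G.errorSpace (G.reduce c k) t ρ) (G.messageSpace (G.reduce c k) t)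
  have hbad : ∀ t ∈ G.sinks, ∀ ρ ∈ Finset.univ.powersetCard (G.minCut t - (m + 1) + 1),
      ((bad t ρ).card : ℝ) ≤ Fintype.card (Fin m → F) / q := by
    intro t ht ρ hρ
    rw [le_div_iff₀ hqpos, hq]
    exact_mod_cast G.card_not_disjoint_reduce_mul_le c t
      (fun X hX => h.vecMul_eq_zero ht (hcut t ht) hX)
      (fun σ hσ => h.disjoint ht (hcut t ht) hσ) (Finset.mem_powersetCard.1 hρ).2
  have hsub : (Finset.univ.filter fun k : Fin m → F => ¬ G.IsMDS (G.reduce c k)) ⊆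
      G.sinks.biUnion fun t =>
        (Finset.univ.powersetCard (G.minCut t - (m + 1) + 1)).biUnion (bad t) := by
    intro k hk
    by_contra hcon
    simp only [Finset.mem_biUnion, not_exists, not_and] at hcon
    refine (Finset.mem_filter.1 hk).2 (h.isMDS_reduce hm hcut k fun t ht ρ hρ => ?_)
    have h1 := hcon t ht ρ (Finset.mem_powersetCard.2 ⟨Finset.subset_univ _, hρ⟩)
    by_contra h2
    exact h1 (Finset.mem_filter.2 ⟨Finset.mem_univ _, h2⟩)
  have hle : ((Finset.univ.filter fun k : Fin m → F => ¬ G.IsMDS (G.reduce c k)).card : ℝ) ≤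
      (∑ t ∈ G.sinks, ((Fintype.card E).choose (G.minCut t - (m + 1) + 1) : ℝ)) / q *
        Fintype.card (Fin m → F) := by
    refine (Nat.cast_le.2 ((Finset.card_le_card hsub).trans (Finset.card_biUnion_le.trans
      (Finset.sum_le_sum fun t _ => Finset.card_biUnion_le)))).trans ?_
    push_cast
    rw [div_mul_eq_mul_div, mul_div_assoc, Finset.sum_mul]
    refine Finset.sum_le_sum fun t ht => (Finset.sum_le_card_nsmul _ _ _ (hbad t ht)).trans ?_
    rw [nsmul_eq_mul, Finset.card_powersetCard, Finset.card_univ]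
  have htot := Finset.card_filter_add_card_filter_not (s := (Finset.univ : Finset (Fin m → F)))
    (fun k => G.IsMDS (G.reduce c k))
  rw [Finset.card_univ] at htot
  have htot' : ((Finset.univ.filter fun k : Fin m → F => G.IsMDS (G.reduce c k)).card : ℝ) +
      (Finset.univ.filter fun k : Fin m → F => ¬ G.IsMDS (G.reduce c k)).card =
        Fintype.card (Fin m → F) := by
    exact_mod_cast htot
  rw [sub_mul, one_mul]
  linarith

/-! ### The probability bounds -/

open Classical in
theorem successProb_eq [Fintype F] (G : Network V E) (m : ℕ) :
    G.successProb F m =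
      ((Finset.univ.filter fun x : G.Code F (m + 1) × (Fin m → F) =>
        G.IsMDS x.1 ∧ G.IsMDS (G.reduce x.1 x.2)).card : ℝ) /
          (Fintype.card (G.Code F (m + 1)) * Fintype.card (Fin m → F)) := by
  rw [successProb, PMF.toOuterMeasure_uniformOfFintype_apply, ENNReal.toReal_div,
    ENNReal.toReal_natCast, ENNReal.toReal_natCast, Fintype.card_prod, Nat.cast_mul]
  congr 2
  exact Fintype.card_subtype _

theorem le_successProb [Fintype F] (G : Network V E) {m : ℕ} (hm : 1 ≤ m)
    (hcut : ∀ t ∈ G.sinks, m + 1 ≤ G.minCut t)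
    (hF : ∑ t ∈ G.sinks, (Fintype.card E).choose (G.minCut t - (m + 1)) < Fintype.card F) :
    (1 - (∑ t ∈ G.sinks, ((Fintype.card E).choose (G.minCut t - (m + 1) + 1) : ℝ)) /
        (Fintype.card F : ℝ)) *
      (1 - (∑ t ∈ G.sinks, ((Fintype.card E).choose (G.minCut t - (m + 1)) : ℝ)) /
        ((Fintype.card F : ℝ) - 1)) ^ (G.internalNodes.card + 1) ≤ G.successProb F m := by
  classical
  have hgen := G.pow_mul_card_le_card_isGeneric (F := F) (w := m + 1) hF
  have hq : (0 : ℝ) < (Fintype.card F : ℝ) - 1 := by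
    have : (1 : ℝ) < Fintype.card F := by exact_mod_cast Fintype.one_lt_card
    linarith
  have hb : 0 ≤ 1 - (∑ t ∈ G.sinks, ((Fintype.card E).choose (G.minCut t - (m + 1)) : ℝ)) /
        ((Fintype.card F : ℝ) - 1) := by
    rw [sub_nonneg, div_le_one hq, le_sub_iff_add_le]
    exact_mod_cast hF
  set a := 1 - (∑ t ∈ G.sinks, ((Fintype.card E).choose (G.minCut t - (m + 1) + 1) : ℝ)) /
        (Fintype.card F : ℝ) with ha
  set b := (1 - (∑ t ∈ G.sinks, ((Fintype.card E).choose (G.minCut t - (m + 1)) : ℝ)) /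
        ((Fintype.card F : ℝ) - 1)) ^ (G.internalNodes.card + 1)
  have hb' : 0 ≤ b := pow_nonneg hb _
  rw [successProb_eq]
  set N : ℝ := (Fintype.card (G.Code F (m + 1)) : ℝ) with hN
  set K : ℝ := (Fintype.card (Fin m → F) : ℝ) with hK
  have hNpos : 0 < N := by rw [hN]; exact_mod_cast Fintype.card_pos
  have hKpos : 0 < K := by rw [hK]; exact_mod_cast Fintype.card_pos
  -- The hypothesis bounds only the sum with C_t - ω, so the first factor may be negative; the bound
  -- is then trivial.
  rcases lt_or_ge a 0 with ha0 | ha0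
  · exact (mul_nonpos_of_nonpos_of_nonneg ha0.le hb').trans (by positivity)
  rw [le_div_iff₀ (mul_pos hNpos hKpos)]
  have hsig : ∑ c ∈ Finset.univ.filter (fun c : G.Code F (m + 1) => G.IsGeneric c),
      (Finset.univ.filter fun k : Fin m → F => G.IsMDS (G.reduce c k)).card ≤
      (Finset.univ.filter fun x : G.Code F (m + 1) × (Fin m → F) =>
        G.IsMDS x.1 ∧ G.IsMDS (G.reduce x.1 x.2)).card := by
    rw [← Finset.card_sigma]
    refine Finset.card_le_card_of_injOn (fun x => (x.1, x.2)) ?_ ?_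
    · rintro ⟨c, k⟩ hx
      obtain ⟨h1, h2⟩ := Finset.mem_sigma.1 (Finset.mem_coe.1 hx)
      refine Finset.mem_coe.2 (Finset.mem_filter.2 ⟨Finset.mem_univ _, ?_,
        (Finset.mem_filter.1 h2).2⟩)
      exact (Finset.mem_filter.1 h1).2.isMDS (by omega) hcut
    · rintro ⟨c, k⟩ - ⟨c', k'⟩ - heq
      simp only [Prod.mk.injEq] at heq
      rw [heq.1, heq.2]
  calc a * b * (N * K) = (b * N) * (a * K) := by ring
    _ ≤ (Finset.univ.filter fun c : G.Code F (m + 1) => G.IsGeneric c).card * (a * K) := by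
        gcongr
    _ ≤ ((∑ c ∈ Finset.univ.filter (fun c : G.Code F (m + 1) => G.IsGeneric c),
        (Finset.univ.filter fun k : Fin m → F => G.IsMDS (G.reduce c k)).card : ℕ) : ℝ) := by
        push_cast
        rw [← nsmul_eq_mul]
        exact Finset.card_nsmul_le_sum _ _ _ fun c hc =>
          (Finset.mem_filter.1 hc).2.le_card_isMDS_reduce hm hcut
    _ ≤ _ := Nat.cast_le.2 hsig

end Network

theorem mainTheorem5 {V E F : Type*} [Fintype V] [DecidableEq V] [Fintype E] [DecidableEq E]
    [Field F] [Fintype F] (G : Network V E) (ω : ℕ) (hω : 2 ≤ ω)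
    (hcut : ∀ t ∈ G.sinks, ω ≤ G.minCut t) :
    (∑ t ∈ G.sinks, (Fintype.card E).choose (G.minCut t - ω) < Fintype.card F →
      (1 - (∑ t ∈ G.sinks, ((Fintype.card E).choose (G.minCut t - ω + 1) : ℝ))
            / (Fintype.card F : ℝ))
        * (1 - (∑ t ∈ G.sinks, ((Fintype.card E).choose (G.minCut t - ω) : ℝ))
            / ((Fintype.card F : ℝ) - 1)) ^ (G.internalNodes.card + 1)
      ≤ G.successProb F (ω - 1)) ∧
    ((∀ t ∈ G.sinks, G.minCut t ≤ Fintype.card E / 2) →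
      ∑ t ∈ G.sinks, (Fintype.card E).choose (G.minCut t - ω + 1) < Fintype.card F →
      (1 - (∑ t ∈ G.sinks, ((Fintype.card E).choose (G.minCut t - ω + 1) : ℝ))
            / ((Fintype.card F : ℝ) - 1)) ^ (G.internalNodes.card + 2)
      ≤ G.successProb F (ω - 1)) := by
  obtain ⟨m, rfl⟩ : ∃ m, ω = m + 1 := ⟨ω - 1, by omega⟩
  rw [Nat.add_sub_cancel]
  refine ⟨G.le_successProb (by omega) hcut, fun hE hF => ?_⟩
  -- As C_t ≤ |E| / 2 and ω ≥ 1, the index C_t - ω is strictly below the middle, where binomial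
  -- coefficients increase. Both factors of (1) are then at least the base of the power in (2).
  have hchoose : ∀ t ∈ G.sinks, (Fintype.card E).choose (G.minCut t - (m + 1)) ≤
      (Fintype.card E).choose (G.minCut t - (m + 1) + 1) := by
    intro t ht
    have h1 := hE t ht
    have h2 := hcut t ht
    exact Nat.choose_le_succ_of_lt_half_left (by omega)
  have hsum := Finset.sum_le_sum hchoose
  refine le_trans ?_ (G.le_successProb (by omega) hcut (hsum.trans_lt hF))
  have hq : (0 : ℝ) < (Fintype.card F : ℝ) - 1 := by
    have : (1 : ℝ) < Fintype.card F := by exact_mod_cast Fintype.one_lt_card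
    linarith
  have hb : (0 : ℝ) ≤ 1 - (∑ t ∈ G.sinks,
      ((Fintype.card E).choose (G.minCut t - (m + 1) + 1) : ℝ)) / ((Fintype.card F : ℝ) - 1) := by
    rw [sub_nonneg, div_le_one hq, le_sub_iff_add_le]
    exact_mod_cast hF
  have hsum' : (∑ t ∈ G.sinks, ((Fintype.card E).choose (G.minCut t - (m + 1)) : ℝ)) ≤
      ∑ t ∈ G.sinks, ((Fintype.card E).choose (G.minCut t - (m + 1) + 1) : ℝ) := by
    exact_mod_cast hsum
  have h1 : 1 - (∑ t ∈ G.sinks, ((Fintype.card E).choose (G.minCut t - (m + 1) + 1) : ℝ)) /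
      ((Fintype.card F : ℝ) - 1) ≤
      1 - (∑ t ∈ G.sinks, ((Fintype.card E).choose (G.minCut t - (m + 1) + 1) : ℝ)) /
        (Fintype.card F : ℝ) :=
    sub_le_sub_left (div_le_div_of_nonneg_left (by positivity) hq (by linarith)) _
  have h2 : 1 - (∑ t ∈ G.sinks, ((Fintype.card E).choose (G.minCut t - (m + 1) + 1) : ℝ)) /
      ((Fintype.card F : ℝ) - 1) ≤
      1 - (∑ t ∈ G.sinks, ((Fintype.card E).choose (G.minCut t - (m + 1)) : ℝ)) /
        ((Fintype.card F : ℝ) - 1) :=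
    sub_le_sub_left (div_le_div_of_nonneg_right hsum' hq.le) _
  rw [show G.internalNodes.card + 2 = G.internalNodes.card + 1 + 1 from rfl, pow_succ']
  exact mul_le_mul h1 (pow_le_pow_left₀ hb h2 _) (pow_nonneg hb _) (hb.trans h1)
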